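/- Let $q=p^m\ge 5$ with $p$ prime, $q\neq 9$ and $4\mid\frac{q-1}{p-1}$, and put $n=\frac{q-1}{4}$. Let $\Gamma(4,q)$ be the Cayley graph on the additive group of the finite field $\mathbb F_q$ with connection set $R_4=\{x^4 : x\in\mathbb F_q,\ x\neq 0\}$, that is, with an edge from $v$ to $w$ if and only if $w-v\in R_4$. Then $\Gamma(4,q)$ is a simple undirected connected graph, all eigenvalues of its adjacency matrix are integers, and its spectrum is as follows, where $\{[\lambda_1]^{e_1},\dots,[\lambda_s]^{e_s}\}$ means that $\lambda_1,\dots,\lambda_s$ are the different eigenvalues and that $e_i$ is the multiplicity of $\lambda_i$. (a) If $p\equiv 1\pmod 4$, then $m=4t$ for some $t\in\mathbb N$. There are integers $c,d$ with $$\sqrt q=c^2+4d^2,\qquad c\equiv 1\pmod 4,\qquad \gcd(c,p)=1;$$ here $c$ is unique and $d$ is unique up to sign. For any such $c,d$, $$\mathrm{Spec}(\Gamma(4,q))=\Big\{[n]^1,\ \big[\tfrac{\sqrt q+4d\sqrt[4]{q}-1}{4}\big]^n,\ \big[\tfrac{\sqrt q-4d\sqrt[4]{q}-1}{4}\big]^n,\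 \big[\tfrac{-\sqrt q+2c\sqrt[4]{q}-1}{4}\big]^n,\ \big[\tfrac{-\sqrt q-2c\sqrt[4]{q}-1}{4}\big]^n\Big\}.$$ (b) If $p\equiv 3\pmod 4$, then $m=2t$ for some $t\in\mathbb N$, and $$\mathrm{Spec}(\Gamma(4,q))=\begin{cases}\big\{[n]^1,\ \big[\tfrac{\sqrt q-1}{4}\big]^{3n},\ \big[\tfrac{-3\sqrt q-1}{4}\big]^n\big\} & \text{if } m\equiv 0\pmod 4,\\[2mm] \big\{[n]^1,\ \big[\tfrac{3\sqrt q-1}{4}\big]^{n},\ \big[\tfrac{-\sqrt q-1}{4}\big]^{3n}\big\} & \text{if } m\equiv 2\pmod 4.\end{cases}$$ In particular, $\Gamma(4,q)$ is a strongly regular graph (neither complete nor edgeless) in this case. -/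

import Mathlib

/-- The set `R_k = {x ^ k : x ≠ 0}` of nonzero `k`-th powers of a field. -/
def nonzeroPowers (k : ℕ) (F : Type*) [Field F] : Set F :=
  {y | ∃ x : F, x ≠ 0 ∧ y = x ^ k}

/-- The generalized Paley graph `Γ(k, q)`: the Cayley graph on the additive group of the field `F`
with connection set the nonzero `k`-th powers.  Mathlib's Cayley graph is the underlying
simple graph; when `R_k = -R_k` it has no other edges than `v → w` with `w - v ∈ R_k`. -/
def genPaley (k : ℕ) (F : Type*) [Field F] : SimpleGraph F :=
  SimpleGraph.addCayley (nonzeroPowers k F)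

open Classical in
/-- The eigenvalues of the (real symmetric) adjacency matrix of a finite simple graph, counted
with multiplicity. -/
noncomputable def graphSpectrum {V : Type*} [Fintype V] (G : SimpleGraph V) : Multiset ℝ :=
  (G.adjMatrix ℝ).charpoly.roots

/-- `HasSpec G [(x₁, e₁), …, (xₛ, eₛ)]` says that `Spec(G) = {[x₁]^e₁, …, [xₛ]^eₛ}`: the `xᵢ` are
the different eigenvalues of `G`, and `eᵢ > 0` is the multiplicity of `xᵢ`. -/
def HasSpec {V : Type*} [Fintype V] (G : SimpleGraph V) (L : List (ℝ × ℕ)) : Prop :=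
  (L.map Prod.fst).Nodup ∧ (∀ x ∈ L, 0 < x.2) ∧
    graphSpectrum G = (L.map fun x => Multiset.replicate x.2 x.1).sum

/-- All eigenvalues of the graph are integers. -/
def HasIntegralSpectrum {V : Type*} [Fintype V] (G : SimpleGraph V) : Prop :=
  ∀ x ∈ graphSpectrum G, ∃ z : ℤ, x = z

open Classical in
/-- A strongly regular graph with some parameters, which is neither complete nor edgeless. -/
def IsStronglyRegular {V : Type*} [Fintype V] (G : SimpleGraph V) : Prop :=
  G ≠ ⊤ ∧ G ≠ ⊥ ∧ ∃ k l m : ℕ, G.IsSRGWith (Fintype.card V) k l m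

/-- `√q = c² + 4d²`, `c ≡ 1 (mod 4)` and `(c, p) = 1`. -/
def IsQuarticPair (p q : ℕ) (c d : ℤ) : Prop :=
  √(q : ℝ) = (c : ℝ) ^ 2 + 4 * (d : ℝ) ^ 2 ∧ c ≡ 1 [ZMOD 4] ∧ IsCoprime c (p : ℤ)

/-! The additive characters `x ↦ ψ (a * x)` diagonalise the adjacency matrix, and the eigenvalues
are the sums of `ψ (a * y)` over the fourth powers `y`. For `a ≠ 0` such a sum depends only on the
coset of `a` modulo fourth powers. So besides `n`, from `a = 0`, there are four quartic periods `e
0, ..., e 3`, each occurring `n` times (`graphSpectrum_genPaley_four`). Since `4 (p - 1)` divides `q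
- 1`, the nonzero elements of the prime field are fourth powers. This makes the periods rational,
and being algebraic integers they are integers (`exists_int_eq_charSum`).

Let `χ` be a character with `χ g = i`. The Gauss sums of `1`, `χ²` and `χ` yield `e 0 + e 1 + e 2 +
e 3 = -1`, `(e 0 - e 1 + e 2 - e 3)² = q` and `(e 0 - e 2)² + (e 1 - e 3)² = q`
(`exists_quartic_periods`). Hence `4 e k + 1 ≤ 3 √q`, which separates the periods from `n` and gives
connectedness. It remains to see how `q` is a sum of two squares.

For `p ≡ 3 (mod 4)` only the trivial decomposition exists, and a congruence modulo 4 settles the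
signs (`semiprimitive_periods`). Two nontrivial eigenvalues are left, whence strong regularity
(`isSRGWith_of_charSum_quadratic`).

For `p ≡ 1 (mod 4)` one uses `G(χ)² = J(χ,χ) G(χ²)`. Modulo a prime of `ℤ[i]` above `p`, the Jacobi
sum becomes `3n choose n` up to sign, which Lucas' theorem shows to be nonzero
(`not_dvd_jacobiSum`). So with `q = p^(4t)`, `G(χ)` is `p^t` times a primitive Gaussian integer of
norm `√q`, which provides `c` and `d`. Primitive representations are unique up to signs
(`sq_eq_sq_of_sq_add_four_mul_sq`), so any pair `c, d` describes the same spectrum. -/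

/-! ### Cayley graphs and character sums -/

open Polynomial in
/-- The characteristic polynomial of a Cayley graph on the additive group of a finite field, from
the sums of the additive characters over the connection set. -/
theorem charpoly_adjMatrix_of_charSum {F : Type*} [Field F] [Fintype F] [DecidableEq F]
    {ψ : AddChar F ℂ} (hψ : ψ.IsPrimitive) (G : SimpleGraph F) [DecidableRel G.Adj] (R : Finset F)
    (hG : ∀ v w, G.Adj v w ↔ w - v ∈ R) (e : F → ℝ)
    (he : ∀ a, ∑ y ∈ R, ψ (a * y) = (e a : ℂ)) :
    (G.adjMatrix ℝ).charpoly = ∏ a, (X - C (e a)) := by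
  set P : Matrix F F ℂ := Matrix.of fun x a => ψ (a * x) with hP
  set Q : Matrix F F ℂ := Matrix.of fun a x => (Fintype.card F : ℂ)⁻¹ * ψ (-(a * x)) with hQ
  have hq : (Fintype.card F : ℂ) ≠ 0 := Nat.cast_ne_zero.mpr Fintype.card_ne_zero
  have hPQ : P * Q = 1 := by
    ext x y
    have h1 : ∀ a : F, P x a * Q a y = (Fintype.card F : ℂ)⁻¹ * ψ (a * (x - y)) := by
      intro a
      simp only [hP, hQ, Matrix.of_apply]
      rw [mul_left_comm, ← AddChar.map_add_eq_mul]
      congr 2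
      ring
    rw [Matrix.mul_apply, Finset.sum_congr rfl fun a _ => h1 a, ← Finset.mul_sum,
      AddChar.sum_mulShift _ hψ, Matrix.one_apply]
    by_cases hxy : x = y
    · simp [hxy]
    · simp [hxy, sub_eq_zero]
  let U : (Matrix F F ℂ)ˣ := ⟨P, Q, hPQ, mul_eq_one_comm.mp hPQ⟩
  -- The columns of `P` are the additive characters, which are eigenvectors.
  have hAP : G.adjMatrix ℂ * P = P * Matrix.diagonal fun a => (e a : ℂ) := by
    ext v a
    rw [Matrix.mul_diagonal, ← he, Matrix.mul_apply]
    simp only [SimpleGraph.adjMatrix_apply, hG, hP, Matrix.of_apply, ite_mul, one_mul, zero_mul]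
    rw [← Finset.sum_filter, Finset.mul_sum]
    refine Finset.sum_nbij' (fun w => w - v) (fun y => v + y) ?_ ?_ ?_ ?_ ?_
    · simp
    · simp
    · simp
    · simp
    · intro w _
      rw [← AddChar.map_add_eq_mul]
      congr 1
      ring
  have hconj : G.adjMatrix ℂ = U.val * (Matrix.diagonal fun a => (e a : ℂ)) * U⁻¹.val := by
    change _ = P * _ * Q
    rw [← hAP, mul_assoc, hPQ, mul_one]
  have hmap : (G.adjMatrix ℝ).map Complex.ofRealHom = G.adjMatrix ℂ := by
    ext v w
    simp only [Matrix.map_apply, SimpleGraph.adjMatrix_apply]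
    split_ifs <;> simp
  apply Polynomial.map_injective Complex.ofRealHom Complex.ofRealHom.injective
  rw [← Matrix.charpoly_map, hmap, hconj, Matrix.coe_units_inv, Matrix.charpoly_units_conj, Matrix.charpoly_diagonal,
    Polynomial.map_prod]
  simp

/-- A Cayley graph on the additive group of a finite field is connected if no nontrivial character
has the degree as its eigenvalue. -/
theorem connected_of_charSum_ne {F : Type*} [Field F] [Fintype F]
    {ψ : AddChar F ℂ} (hψ : ψ.IsPrimitive) (G : SimpleGraph F) (R : Finset F)
    (hG : ∀ v w, G.Adj v w ↔ w - v ∈ R)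
    (he : ∀ a, a ≠ 0 → ∑ y ∈ R, ψ (a * y) ≠ (R.card : ℂ)) :
    G.Connected := by
  classical
  set H : Finset F := Finset.univ.filter fun x => G.Reachable 0 x with hH
  have hshift : ∀ y ∈ R, ∀ x, G.Reachable 0 x ↔ G.Reachable 0 (x + y) := by
    intro y hy x
    have hadj : G.Adj x (x + y) := (hG _ _).mpr (by simpa using hy)
    exact ⟨fun h => h.trans hadj.reachable, fun h => h.trans hadj.symm.reachable⟩
  -- The component `H` of 0 is invariant under translation by `R`. Averaging over `R` shows that its
  -- Fourier coefficient at `a` vanishes unless the character sum equals `|R|`.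
  have hhat : ∀ a, a ≠ 0 → ∑ h ∈ H, ψ (a * h) = 0 := by
    intro a ha
    have h1 : ∀ y ∈ R, ψ (a * y) * ∑ h ∈ H, ψ (a * h) = ∑ h ∈ H, ψ (a * h) := by
      intro y hy
      rw [Finset.mul_sum]
      refine Finset.sum_nbij' (fun h => h + y) (fun h => h - y) ?_ ?_ ?_ ?_ ?_
      · intro x hx
        simpa [hH, ← hshift y hy x] using hx
      · intro x hx
        have := hshift y hy (x - y)
        rw [sub_add_cancel] at this
        simpa [hH, this] using hx
      · simp
      · simp
      · intro x _
        rw [← AddChar.map_add_eq_mul]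
        congr 1
        ring
    have h2 := Finset.sum_congr rfl h1
    rw [← Finset.sum_mul, Finset.sum_const, nsmul_eq_mul] at h2
    have h3 : (∑ y ∈ R, ψ (a * y) - (R.card : ℂ)) * ∑ h ∈ H, ψ (a * h) = 0 := by
      rw [sub_mul, h2, sub_self]
    exact (mul_eq_zero.mp h3).resolve_left (sub_ne_zero.mpr (he a ha))
  -- Fourier inversion at the point `0 ∈ H`; only `a = 0` survives, so `|H| = |F|`.
  have htot : ∑ a : F, ∑ h ∈ H, ψ (a * h) = (Fintype.card F : ℂ) := by
    rw [Finset.sum_comm, Finset.sum_eq_single (0 : F)]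
    · simp
    · intro b _ hb
      rw [AddChar.sum_mulShift _ hψ, if_neg hb, Nat.cast_zero]
    · intro h0
      exact absurd (by simp [hH]) h0
  rw [Finset.sum_eq_single (0 : F) (fun a _ ha => hhat a ha) (by simp)] at htot
  simp only [zero_mul, AddChar.map_zero_eq_one, Finset.sum_const, nsmul_eq_mul, mul_one,
    Nat.cast_inj] at htot
  have hall : ∀ x, G.Reachable 0 x := by
    intro x
    have hx : x ∈ H := by
      rw [Finset.eq_univ_of_card H htot]
      exact Finset.mem_univ x
    simpa [hH] using hx
  have : Nonempty F := ⟨0⟩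
  exact SimpleGraph.Connected.mk fun x y => (hall x).symm.trans (hall y)

/-- A Cayley graph on the additive group of a finite field is strongly regular if the nontrivial
characters yield at most two eigenvalues. -/
theorem isSRGWith_of_charSum_quadratic {F : Type*} [Field F] [Fintype F] [DecidableEq F]
    {ψ : AddChar F ℂ} (hψ : ψ.IsPrimitive) (G : SimpleGraph F) [DecidableRel G.Adj] (R : Finset F)
    (hG : ∀ v w, G.Adj v w ↔ w - v ∈ R) (s t : ℂ)
    (he : ∀ a, a ≠ 0 → (∑ y ∈ R, ψ (a * y)) ^ 2 = s * ∑ y ∈ R, ψ (a * y) - t) :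
    ∃ k l m : ℕ, G.IsSRGWith (Fintype.card F) k l m := by
  have hneg : ∀ y, y ∈ R ↔ -y ∈ R := by
    intro y
    have h1 := hG 0 y
    have h2 := hG y 0
    rw [sub_zero] at h1
    rw [zero_sub] at h2
    rw [← h1, ← h2, G.adj_comm]
  set N : F → ℕ := fun b => (R.filter fun x => b - x ∈ R).card with hN
  have hq : (Fintype.card F : ℂ) ≠ 0 := Nat.cast_ne_zero.mpr Fintype.card_ne_zero
  -- Squares of character sums are the Fourier coefficients of the convolution of `R` with itself,
  -- whose value at `b` is `N b`.
  have hpair : ∀ b, ∑ a : F, (∑ y ∈ R, ψ (a * y)) ^ 2 * ψ (-(a * b))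
      = (Fintype.card F : ℂ) * N b := by
    intro b
    have h1 : ∀ a : F, (∑ y ∈ R, ψ (a * y)) ^ 2 * ψ (-(a * b))
        = ∑ x ∈ R, ∑ y ∈ R, ψ (a * (x + y - b)) := by
      intro a
      rw [sq, Finset.sum_mul_sum, Finset.sum_mul]
      refine Finset.sum_congr rfl fun x _ => ?_
      rw [Finset.sum_mul]
      refine Finset.sum_congr rfl fun y _ => ?_
      rw [← AddChar.map_add_eq_mul, ← AddChar.map_add_eq_mul]
      congr 1
      ring
    rw [Finset.sum_congr rfl fun a _ => h1 a, Finset.sum_comm]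
    have h2 : ∀ x ∈ R, ∑ a : F, ∑ y ∈ R, ψ (a * (x + y - b))
        = if b - x ∈ R then (Fintype.card F : ℂ) else 0 := by
      intro x _
      rw [Finset.sum_comm, ← Finset.sum_ite_eq' R (b - x) fun _ => (Fintype.card F : ℂ)]
      refine Finset.sum_congr rfl fun y _ => ?_
      rw [AddChar.sum_mulShift _ hψ]
      have : x + y - b = 0 ↔ y = b - x := by
        rw [sub_eq_zero, eq_sub_iff_add_eq, add_comm]
      simp only [this]
      split_ifs <;> simp
    rw [Finset.sum_congr rfl h2, ← Finset.sum_filter, Finset.sum_const, nsmul_eq_mul, mul_comm]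
  have hlin : ∀ b, ∑ a : F, (∑ y ∈ R, ψ (a * y)) * ψ (-(a * b))
      = if b ∈ R then (Fintype.card F : ℂ) else 0 := by
    intro b
    rw [← Finset.sum_ite_eq' R b fun _ => (Fintype.card F : ℂ)]
    simp_rw [Finset.sum_mul]
    rw [Finset.sum_comm]
    refine Finset.sum_congr rfl fun y _ => ?_
    have h1 : ∀ a : F, ψ (a * y) * ψ (-(a * b)) = ψ (a * (y - b)) := by
      intro a
      rw [← AddChar.map_add_eq_mul]
      congr 1
      ring
    rw [Finset.sum_congr rfl fun a _ => h1 a, AddChar.sum_mulShift _ hψ]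
    simp only [sub_eq_zero]
    split_ifs <;> simp
  have hconst : ∀ b, b ≠ 0 → ∑ a : F, ψ (-(a * b)) = 0 := by
    intro b hb
    simp_rw [← mul_neg]
    rw [AddChar.sum_mulShift _ hψ, if_neg (neg_ne_zero.mpr hb), Nat.cast_zero]
  have hcount : ∀ b, b ≠ 0 → (Fintype.card F : ℂ) * N b
      = ((R.card : ℂ) ^ 2 - s * R.card + t)
        + s * if b ∈ R then (Fintype.card F : ℂ) else 0 := by
    intro b hb
    -- The quadratic relation is only assumed for `a ≠ 0`; the last term corrects it at `a = 0`,
    -- where the sum is `|R|`.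
    have h1 : ∀ a : F, (∑ y ∈ R, ψ (a * y)) ^ 2 * ψ (-(a * b))
        = (s * ((∑ y ∈ R, ψ (a * y)) * ψ (-(a * b))) - t * ψ (-(a * b)))
          + if a = 0 then (R.card : ℂ) ^ 2 - s * R.card + t else 0 := by
      intro a
      by_cases ha : a = 0
      · simp [ha]
      · rw [he a ha, if_neg ha]
        ring
    rw [← hpair, Finset.sum_congr rfl fun a _ => h1 a, Finset.sum_add_distrib,
      Finset.sum_sub_distrib, ← Finset.mul_sum, ← Finset.mul_sum, hlin, hconst b hb]
    simp
    ring
  have hdep : ∀ b b', b ≠ 0 → b' ≠ 0 → (b ∈ R ↔ b' ∈ R) → N b = N b' := by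
    intro b b' hb hb' h
    have := (hcount b hb).trans (by rw [hcount b' hb']; simp only [h] :
      _ = (Fintype.card F : ℂ) * N b')
    exact_mod_cast mul_left_cancel₀ hq this
  -- On an empty class any parameter serves; 0 is taken.
  have hval : ∀ S : Set F, (∀ b ∈ S, ∀ b' ∈ S, N b = N b') → ∃ c, ∀ b ∈ S, N b = c := by
    intro S hS
    rcases S.eq_empty_or_nonempty with rfl | ⟨b₀, hb₀⟩
    · exact ⟨0, by simp⟩
    · exact ⟨N b₀, fun b hb => hS b hb b₀ hb₀⟩
  have hcommon : ∀ v w, Fintype.card (G.commonNeighbors v w) = N (w - v) := by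
    intro v w
    rw [show N (w - v) = (R.filter fun x => w - v - x ∈ R).card from rfl, ← Fintype.card_coe]
    refine Fintype.card_congr ⟨fun z => ⟨z.1 - v, ?_⟩, fun x => ⟨x.1 + v, ?_⟩, ?_, ?_⟩
    · obtain ⟨z, hz⟩ := z
      rw [SimpleGraph.mem_commonNeighbors, hG, hG] at hz
      rw [Finset.mem_filter, sub_sub_sub_cancel_right, hneg (w - z), neg_sub]
      exact hz
    · obtain ⟨x, hx⟩ := x
      rw [Finset.mem_filter, hneg (w - v - x)] at hx
      rw [SimpleGraph.mem_commonNeighbors, hG, hG]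
      refine ⟨by simpa using hx.1, ?_⟩
      convert hx.2 using 1
      ring
    · intro z
      simp
    · intro x
      simp
  have h0 : (0 : F) ∉ R := fun h => G.irrefl ((hG 0 0).mpr (by simpa using h))
  obtain ⟨l, hl⟩ := hval {b | b ∈ R} fun b hb b' hb' =>
    hdep b b' (fun h => h0 (h ▸ hb)) (fun h => h0 (h ▸ hb')) (iff_of_true hb hb')
  obtain ⟨m, hm⟩ := hval {b | b ≠ 0 ∧ b ∉ R} fun b hb b' hb' =>
    hdep b b' hb.1 hb'.1 (iff_of_false hb.2 hb'.2)
  refine ⟨R.card, l, m, rfl, ?_, ?_, ?_⟩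
  · intro v
    rw [← SimpleGraph.card_neighborFinset_eq_degree]
    refine Finset.card_nbij' (fun w => w - v) (fun y => y + v) ?_ ?_ ?_ ?_
    · intro w hw
      simpa [hG] using hw
    · intro y hy
      simpa [hG] using hy
    · intro w _
      simp
    · intro y _
      simp
  · intro v w hvw
    rw [hcommon, hl _ ((hG v w).mp hvw)]
  · intro v w hne hvw
    rw [hcommon, hm _ ⟨sub_ne_zero.mpr hne.symm, fun h => hvw ((hG v w).mpr h)⟩]

/-! ### Prime powers as sums of two squares -/

/-- A power of a prime `p ≡ 3 (mod 4)` with even exponent is a sum of two squares only trivially. -/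
theorem eq_zero_or_eq_zero_of_sq_add_sq_eq_pow {p : ℕ} (hp : p.Prime) (hp3 : p % 4 = 3) (s : ℕ) :
    ∀ u v : ℤ, u ^ 2 + v ^ 2 = (p : ℤ) ^ (2 * s) → u = 0 ∨ v = 0 := by
  have : Fact p.Prime := ⟨hp⟩
  have hp0 : (p : ℤ) ≠ 0 := by exact_mod_cast hp.ne_zero
  -- Otherwise `u / v` would be a square root of -1 modulo `p`. This drives a descent dividing both
  -- squares by `p ^ 2`.
  have key : ∀ u v : ℤ, (p : ℤ) ∣ u ^ 2 + v ^ 2 → (p : ℤ) ∣ v := by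
    intro u v h
    rw [← ZMod.intCast_zmod_eq_zero_iff_dvd] at h ⊢
    push_cast at h
    by_contra hv
    refine (ZMod.exists_sq_eq_neg_one_iff (p := p)).mp ⟨(u : ZMod p) * (v : ZMod p)⁻¹, ?_⟩ hp3
    field_simp
    linear_combination -h
  induction s with
  | zero =>
    intro u v h
    by_contra! hne
    have h1 : 0 < u ^ 2 := by have := hne.1; positivity
    have h2 : 0 < v ^ 2 := by have := hne.2; positivity
    rw [mul_zero, pow_zero] at h
    omega
  | succ s ih =>
    intro u v h
    have hd : (p : ℤ) ∣ u ^ 2 + v ^ 2 := h ▸ dvd_pow_self _ (by omega)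
    obtain ⟨v', rfl⟩ := key u v hd
    obtain ⟨u', rfl⟩ := key _ u ((add_comm (u ^ 2) _) ▸ hd)
    have h' : u' ^ 2 + v' ^ 2 = (p : ℤ) ^ (2 * s) := by
      apply mul_left_cancel₀ (pow_ne_zero 2 hp0)
      rw [← pow_add]
      rw [show 2 * (s + 1) = 2 + 2 * s by ring] at h
      linear_combination h
    rcases ih u' v' h' with h0 | h0
    · exact Or.inl (by rw [h0, mul_zero])
    · exact Or.inr (by rw [h0, mul_zero])

/-- Primitive representations of a power of an odd prime `p` by `c² + 4d²` are unique up to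
signs. -/
theorem sq_eq_sq_of_sq_add_four_mul_sq {p : ℕ} (hp : p.Prime) (hp2 : p ≠ 2) {k : ℕ}
    {c d c' d' : ℤ} (h : c ^ 2 + 4 * d ^ 2 = (p : ℤ) ^ k) (h' : c' ^ 2 + 4 * d' ^ 2 = (p : ℤ) ^ k)
    (hc : IsCoprime c (p : ℤ)) (hc' : IsCoprime c' (p : ℤ)) (hk : k ≠ 0) :
    c' ^ 2 = c ^ 2 ∧ d' ^ 2 = d ^ 2 := by
  have hpi : Prime (p : ℤ) := Nat.prime_iff_prime_int.mp hp
  have hP : 0 < (p : ℤ) ^ k := pow_pos (by exact_mod_cast hp.pos) k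
  have hpk : (p : ℤ) ∣ (p : ℤ) ^ k := dvd_pow_self _ hk
  have hc0 : ¬ (p : ℤ) ∣ c := fun hd => hpi.not_isUnit (hc.symm.isUnit_of_dvd hd)
  have hc'0 : ¬ (p : ℤ) ∣ c' := fun hd => hpi.not_isUnit (hc'.symm.isUnit_of_dvd hd)
  have hd'0 : ¬ (p : ℤ) ∣ d' := by
    intro hd
    refine hc'0 (hpi.dvd_of_dvd_pow (n := 2) ?_)
    have : c' ^ 2 = (p : ℤ) ^ k - d' * (4 * d') := by linear_combination h'
    rw [this]
    exact dvd_sub hpk (hd.mul_right _)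
  have hp2' : ¬ (p : ℤ) ∣ 2 := by
    intro hd
    have : p ∣ 2 := by exact_mod_cast hd
    exact hp2 ((Nat.prime_dvd_prime_iff_eq hp Nat.prime_two).mp this)
  -- The product equals `p^k (d'² - d²)`. As `p` cannot divide both factors, `p^k` divides one of
  -- them.
  have hprod : (p : ℤ) ^ k ∣ (c * d' - c' * d) * (c * d' + c' * d) :=
    ⟨d' ^ 2 - d ^ 2, by linear_combination d' ^ 2 * h - d ^ 2 * h'⟩
  have hsum : ¬ ((p : ℤ) ∣ c * d' - c' * d ∧ (p : ℤ) ∣ c * d' + c' * d) := by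
    rintro ⟨h1, h2⟩
    have h3 := dvd_add h1 h2
    rw [show c * d' - c' * d + (c * d' + c' * d) = 2 * (c * d') by ring] at h3
    rcases hpi.dvd_or_dvd h3 with h4 | h4
    · exact hp2' h4
    · rcases hpi.dvd_or_dvd h4 with h5 | h5
      · exact hc0 h5
      · exact hd'0 h5
  have hcop : ∀ x : ℤ, ¬ (p : ℤ) ∣ x → IsCoprime ((p : ℤ) ^ k) x := fun x hx =>
    ((Prime.coprime_iff_not_dvd hpi).mpr hx).pow_left
  -- Multiplicativity of the norm, `(cc' ± 4dd')² + 4(cd' ∓ c'd)² = p^(2k)`, makes each factor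
  -- smaller than `p^k`, so the divisible one is zero.
  have hzero : (c * d' - c' * d) * (c * d' + c' * d) = 0 := by
    by_cases h1 : (p : ℤ) ∣ c * d' - c' * d
    · have h2 := (hcop _ fun h2 => hsum ⟨h1, h2⟩).dvd_of_dvd_mul_right hprod
      rw [Int.eq_zero_of_abs_lt_dvd h2 (abs_lt_of_sq_lt_sq ?_ hP.le), zero_mul]
      nlinarith [sq_nonneg (c * c' + 4 * d * d'), sq_nonneg (c * d' - c' * d)]
    · have h2 := (hcop _ h1).dvd_of_dvd_mul_left hprod
      rw [Int.eq_zero_of_abs_lt_dvd h2 (abs_lt_of_sq_lt_sq ?_ hP.le), mul_zero]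
      nlinarith [sq_nonneg (c * c' - 4 * d * d'), sq_nonneg (c * d' + c' * d)]
  have hd : d' ^ 2 = d ^ 2 := by
    have h1 : (p : ℤ) ^ k * (d' ^ 2 - d ^ 2) = 0 := by
      linear_combination hzero - d' ^ 2 * h + d ^ 2 * h'
    exact sub_eq_zero.mp ((mul_eq_zero.mp h1).resolve_left hP.ne')
  exact ⟨by linear_combination h' - h - 4 * hd, hd⟩

/-- If `(u + iv)²` equals `G (x + iy)` with `G = ±p^(2t)` and `p ∤ x + iy`, then `p^t` divides
`u + iv` exactly, provided that `u + iv` has norm `p^(4t)`. -/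
theorem exists_primitive_part_of_sq_eq {p t : ℕ} (hp : p.Prime) (hp2 : p ≠ 2) (ht : t ≠ 0)
    {u v G x y : ℤ} (huv : u ^ 2 + v ^ 2 = (p : ℤ) ^ (4 * t)) (hG : G ^ 2 = (p : ℤ) ^ (4 * t))
    (hx : u ^ 2 - v ^ 2 = G * x) (hy : 2 * u * v = G * y)
    (hxy : ¬ ((p : ℤ) ∣ x ∧ (p : ℤ) ∣ y)) :
    ∃ u' v' : ℤ, u = (p : ℤ) ^ t * u' ∧ v = (p : ℤ) ^ t * v' ∧
      u' ^ 2 + v' ^ 2 = (p : ℤ) ^ (2 * t) ∧ IsCoprime u' (p : ℤ) ∧ IsCoprime v' (p : ℤ) := by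
  have hpi : Prime (p : ℤ) := Nat.prime_iff_prime_int.mp hp
  have hp0 : (p : ℤ) ≠ 0 := hpi.ne_zero
  have hp2' : ¬ (p : ℤ) ∣ 2 := by
    intro hd
    have : p ∣ 2 := by exact_mod_cast hd
    exact hp2 ((Nat.prime_dvd_prime_iff_eq hp Nat.prime_two).mp this)
  have hcop : IsCoprime (((p : ℤ) ^ t) ^ 2) 2 :=
    ((Prime.coprime_iff_not_dvd hpi).mpr hp2').pow_left.pow_left
  have hP : (p : ℤ) ^ (4 * t) = ((p : ℤ) ^ t) ^ 4 := by rw [← pow_mul, mul_comm]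
  have hP2 : (p : ℤ) ^ (2 * t) = ((p : ℤ) ^ t) ^ 2 := by rw [← pow_mul, mul_comm]
  have hpt : (p : ℤ) ∣ (p : ℤ) ^ t := dvd_pow_self _ ht
  have hpt0 : (p : ℤ) ^ t ≠ 0 := pow_ne_zero _ hp0
  rw [hP] at huv hG
  rw [hP2]
  set r : ℤ := (p : ℤ) ^ t with hr
  have hGr : r ^ 2 ∣ G := by
    have : (G - r ^ 2) * (G + r ^ 2) = 0 := by linear_combination hG
    rcases mul_eq_zero.mp this with h | h
    · exact ⟨1, by linear_combination h⟩
    · exact ⟨-1, by linear_combination h⟩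
  obtain ⟨ε, rfl⟩ := hGr
  have hε : ε ^ 2 = 1 := by
    apply mul_left_cancel₀ (pow_ne_zero 4 hpt0)
    linear_combination hG
  -- Adding the norm to the real part gives `2u² = r² (r² + εx)`, and `p` is odd.
  have hu : r ∣ u := by
    rw [← Int.pow_dvd_pow_iff two_ne_zero]
    refine hcop.dvd_of_dvd_mul_left ⟨r ^ 2 + ε * x, ?_⟩
    linear_combination huv + hx
  have hv : r ∣ v := by
    rw [← Int.pow_dvd_pow_iff two_ne_zero]
    refine hcop.dvd_of_dvd_mul_left ⟨r ^ 2 - ε * x, ?_⟩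
    linear_combination huv - hx
  obtain ⟨u', rfl⟩ := hu
  obtain ⟨v', rfl⟩ := hv
  have hnorm : u' ^ 2 + v' ^ 2 = r ^ 2 := by
    apply mul_left_cancel₀ (pow_ne_zero 2 hpt0)
    linear_combination huv
  have hx' : x = ε * (u' ^ 2 - v' ^ 2) := by
    apply mul_left_cancel₀ (pow_ne_zero 2 hpt0)
    linear_combination -ε * hx - r ^ 2 * x * hε
  have hy' : y = ε * (2 * u' * v') := by
    apply mul_left_cancel₀ (pow_ne_zero 2 hpt0)
    linear_combination -ε * hy - r ^ 2 * y * hε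
  have hpr : (p : ℤ) ∣ r ^ 2 := hpt.trans (dvd_pow_self _ two_ne_zero)
  have hnot : ¬ ((p : ℤ) ∣ u' ∧ (p : ℤ) ∣ v') := by
    rintro ⟨h1, h2⟩
    refine hxy ⟨?_, ?_⟩
    · rw [hx']
      exact (dvd_sub (dvd_pow h1 two_ne_zero) (dvd_pow h2 two_ne_zero)).mul_left _
    · rw [hy']
      exact (h2.mul_left _).mul_left _
  have hiff : (p : ℤ) ∣ u' ↔ (p : ℤ) ∣ v' := by
    have h1 := (Int.dvd_iff_dvd_of_dvd_add (hnorm ▸ hpr) : (p : ℤ) ∣ u' ^ 2 ↔ (p : ℤ) ∣ v' ^ 2)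
    rwa [hpi.dvd_pow_iff_dvd two_ne_zero, hpi.dvd_pow_iff_dvd two_ne_zero] at h1
  refine ⟨u', v', rfl, rfl, hnorm, ?_, ?_⟩
  · exact ((Prime.coprime_iff_not_dvd hpi).mpr fun h => hnot ⟨h, hiff.mp h⟩).symm
  · exact ((Prime.coprime_iff_not_dvd hpi).mpr fun h => hnot ⟨hiff.mpr h, h⟩).symm

/-! ### A binomial coefficient modulo `p` -/

/-- If `p = 4b + 1` and `n = b (1 + p + ⋯ + p^(m-1))`, then `p` does not divide `3n choose n`. -/
theorem not_dvd_choose_three_mul {p b : ℕ} (hp : p.Prime) (hb : p = 4 * b + 1) (m : ℕ) :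
    ∀ n, 4 * n + 1 = p ^ m → ¬ p ∣ (3 * n).choose n := by
  have : Fact p.Prime := ⟨hp⟩
  induction m with
  | zero =>
    intro n hn
    obtain rfl : n = 0 := by simpa using hn
    simpa using hp.one_lt.ne'
  | succ m ih =>
    intro n hn
    have hmod : p ^ m % 4 = 1 := by
      have h1 : p ≡ 1 [MOD 4] := by rw [hb, Nat.ModEq]; omega
      have h2 := h1.pow m
      rwa [one_pow] at h2
    obtain ⟨k, hk⟩ : ∃ k, 4 * k + 1 = p ^ m := ⟨p ^ m / 4, by omega⟩
    have hnk : n = b + p * k := by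
      rw [pow_succ, ← hk] at hn
      rw [hb] at hn ⊢
      linarith
    have h3 : 3 * n = 3 * b + p * (3 * k) := by rw [hnk]; ring
    -- Lucas' theorem: the last base-`p` digits of `n` and `3n` are `b` and `3b < p`. There is no
    -- carry, and the remaining digits are those of `k` and `3k`.
    have hmain := Choose.choose_modEq_choose_mod_mul_choose_div_nat (p := p) (n := 3 * n) (k := n)
    rw [h3, hnk, Nat.add_mul_mod_self_left, Nat.add_mul_mod_self_left,
      Nat.add_mul_div_left _ _ hp.pos, Nat.add_mul_div_left _ _ hp.pos,
      Nat.mod_eq_of_lt (by omega : b < p), Nat.mod_eq_of_lt (by omega : 3 * b < p),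
      Nat.div_eq_of_lt (by omega : b < p), Nat.div_eq_of_lt (by omega : 3 * b < p),
      zero_add, zero_add, ← hnk, ← h3] at hmain
    rw [hmain.dvd_iff dvd_rfl]
    intro hd
    rcases (hp.dvd_mul).mp hd with h | h
    · have hfac : p ∣ (3 * b).factorial := by
        rw [← Nat.choose_mul_factorial_mul_factorial (by omega : b ≤ 3 * b), mul_assoc]
        exact h.mul_right _
      have := (hp.dvd_factorial).mp hfac
      omega
    · exact ih k hk h

theorem Finset.sum_range_four_mul {M : Type*} [AddCommMonoid M] (n : ℕ) (f : ℕ → M) :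
    ∑ k ∈ Finset.range (4 * n), f k
      = ∑ l ∈ Finset.range n, (f (4 * l) + f (4 * l + 1) + f (4 * l + 2) + f (4 * l + 3)) := by
  induction n with
  | zero => simp
  | succ n ih =>
    rw [Finset.sum_range_succ, ← ih, show 4 * (n + 1) = 4 * n + 1 + 1 + 1 + 1 by ring,
      Finset.sum_range_succ, Finset.sum_range_succ, Finset.sum_range_succ, Finset.sum_range_succ]
    simp only [add_assoc]

/-! ### Integrality of character sums -/

/-- A finite field has a primitive additive character with values in `ℂ`. -/
theorem exists_isPrimitive_addChar_complex (F : Type*) [Field F] [Finite F] :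
    ∃ ψ : AddChar F ℂ, ψ.IsPrimitive := by
  obtain ⟨ψ, hψ⟩ := AddChar.exists_apply_ne_zero.mpr (one_ne_zero (α := F))
  refine ⟨ψ, AddChar.IsPrimitive.of_ne_one fun h => hψ ?_⟩
  rw [h, AddChar.one_apply]

/-- Character sums over a set that is stable under the prime field are integers. -/
theorem exists_int_eq_charSum {F : Type*} [Field F] [Finite F] {p : ℕ} (hp : p.Prime) [CharP F p]
    (ψ : AddChar F ℂ) (R : Finset F) (hR : ∀ c : ℕ, (c : F) ≠ 0 → ∀ y ∈ R, (c : F) * y ∈ R)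
    (a : F) : ∃ z : ℤ, ∑ y ∈ R, ψ (a * y) = z := by
  classical
  set T : ℂ := ∑ y ∈ R, ψ (a * y) with hT
  have hroot : ∀ y, ψ y ^ p = 1 := by
    intro y
    rw [← AddChar.map_nsmul_eq_pow, nsmul_eq_mul, CharP.cast_eq_zero, zero_mul,
      AddChar.map_zero_eq_one]
  have hmul : ∀ c ∈ Finset.Ico 1 p, ∑ y ∈ R, ψ (a * y) ^ c = T := by
    intro c hc
    rw [Finset.mem_Ico] at hc
    have hc0 : (c : F) ≠ 0 := by
      rw [Ne, CharP.cast_eq_zero_iff F p]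
      exact fun h => absurd (Nat.le_of_dvd hc.1 h) (by omega)
    have himg : R.image (fun y => (c : F) * y) = R := by
      refine Finset.eq_of_subset_of_card_le ?_ ?_
      · intro y hy
        obtain ⟨x, hx, rfl⟩ := Finset.mem_image.mp hy
        exact hR c hc0 x hx
      · rw [Finset.card_image_of_injective _ (mul_right_injective₀ hc0)]
    rw [hT]
    conv_rhs => rw [← himg]
    rw [Finset.sum_image fun x _ y _ h => mul_right_injective₀ hc0 h]
    refine Finset.sum_congr rfl fun y _ => ?_
    rw [← AddChar.map_nsmul_eq_pow, nsmul_eq_mul]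
    congr 1
    ring
  -- Summing `hmul` over `c` will express `(p - 1) T` through these sums over nontrivial powers of a
  -- `p`-th root of unity, each `p - 1` or `-1`. Hence `T` is rational.
  have hgeom : ∀ y ∈ R, ∃ z : ℤ, ∑ c ∈ Finset.Ico 1 p, ψ (a * y) ^ c = z := by
    intro y _
    have hsplit : ∑ c ∈ Finset.range p, ψ (a * y) ^ c
        = ∑ c ∈ Finset.Ico 1 p, ψ (a * y) ^ c + 1 := by
      rw [Finset.range_eq_Ico, Finset.sum_eq_sum_Ico_succ_bot hp.pos]
      simp [add_comm]
    by_cases h1 : ψ (a * y) = 1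
    · exact ⟨((p - 1 : ℕ) : ℤ), by simp [h1]⟩
    · refine ⟨-1, ?_⟩
      have h2 := geom_sum_eq h1 p
      rw [hroot, sub_self, zero_div, hsplit] at h2
      push_cast
      linear_combination h2
  choose! w hw using hgeom
  have hsum : ((p - 1 : ℕ) : ℂ) * T = ((∑ y ∈ R, w y : ℤ) : ℂ) := by
    have h1 := Finset.sum_congr rfl hmul
    rw [Finset.sum_comm, Finset.sum_congr rfl hw, Finset.sum_const, Nat.card_Ico,
      nsmul_eq_mul] at h1
    rw [← h1]
    push_cast
    rfl
  have hp1 : ((p - 1 : ℕ) : ℂ) ≠ 0 := Nat.cast_ne_zero.mpr (Nat.sub_ne_zero_of_lt hp.one_lt)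
  set r : ℚ := ((∑ y ∈ R, w y : ℤ) : ℚ) / ((p - 1 : ℕ) : ℚ) with hr
  have hTr : algebraMap ℚ ℂ r = T := by
    rw [hr, eq_ratCast]
    push_cast
    rw [div_eq_iff (by exact_mod_cast hp1), mul_comm]
    push_cast at hsum
    exact hsum.symm
  have hint : IsIntegral ℤ T :=
    IsIntegral.sum _ fun y _ => IsIntegral.of_pow hp.pos (by rw [hroot]; exact isIntegral_one)
  rw [← hTr, isIntegral_algebraMap_iff (algebraMap ℚ ℂ).injective,
    IsIntegrallyClosed.isIntegral_iff] at hint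
  obtain ⟨z, hz⟩ := hint
  exact ⟨z, by rw [← hTr, ← hz]; simp⟩

/-! ### Fourth powers as powers of a generator -/

/-- The set of nonzero fourth powers as a finset. -/
noncomputable def fourthPowers (F : Type*) [Field F] [Fintype F] : Finset F :=
  open Classical in Finset.univ.filter (· ∈ nonzeroPowers 4 F)

theorem mem_fourthPowers {F : Type*} [Field F] [Fintype F] {y : F} :
    y ∈ fourthPowers F ↔ y ∈ nonzeroPowers 4 F := by
  simp [fourthPowers]

section Generator

variable {F : Type*} [Field F] [Fintype F] {n : ℕ} (hn : Fintype.card F = 4 * n + 1)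
  {g : Fˣ} (hg : ∀ x, x ∈ Subgroup.zpowers g)

include hn hg

theorem orderOf_generator_eq : orderOf g = 4 * n := by
  rw [orderOf_eq_card_of_forall_mem_zpowers hg, Nat.card_units, Nat.card_eq_fintype_card, hn,
    Nat.add_sub_cancel]

theorem exists_generator_pow_eq {y : F} (hy : y ≠ 0) : ∃ k < 4 * n, (g : F) ^ k = y := by
  classical
  obtain ⟨k, hk, hk'⟩ := (isOfFinOrder_of_finite g).mem_zpowers_iff_mem_range_orderOf.mp
    (hg (Units.mk0 y hy)) |> Finset.mem_image.mp
  rw [Finset.mem_range, orderOf_generator_eq hn hg] at hk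
  exact ⟨k, hk, by rw [← Units.val_pow_eq_pow_val, hk', Units.val_mk0]⟩

theorem generator_pow_inj {k l : ℕ} (hk : k < 4 * n) (hl : l < 4 * n)
    (h : (g : F) ^ k = (g : F) ^ l) : k = l := by
  rw [← Units.val_pow_eq_pow_val, ← Units.val_pow_eq_pow_val, Units.val_inj] at h
  rw [← orderOf_generator_eq hn hg] at hk hl
  exact pow_injOn_Iio_orderOf hk hl h

theorem generator_pow_two_mul (hn0 : 0 < n) : (g : F) ^ (2 * n) = -1 := by
  have h4 : (g : F) ^ (4 * n) = 1 := by
    rw [← orderOf_generator_eq hn hg, ← Units.val_pow_eq_pow_val, pow_orderOf_eq_one, Units.val_one]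
  have h : ((g : F) ^ (2 * n) - 1) * ((g : F) ^ (2 * n) + 1) = 0 := by
    have h2 : (g : F) ^ (4 * n) = (g : F) ^ (2 * n) * (g : F) ^ (2 * n) := by
      rw [← pow_add]; congr 1; ring
    linear_combination h4 - h2
  rcases mul_eq_zero.mp h with h | h
  · have := generator_pow_inj hn hg (k := 2 * n) (l := 0) (by omega) (by omega)
      (by rw [pow_zero]; exact sub_eq_zero.mp h)
    omega
  · exact eq_neg_of_add_eq_zero_left h

theorem generator_pow_mem_fourthPowers_iff {k : ℕ} : (g : F) ^ k ∈ fourthPowers F ↔ 4 ∣ k := by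
  rw [mem_fourthPowers]
  constructor
  · rintro ⟨x, hx, h⟩
    obtain ⟨l, _, rfl⟩ := exists_generator_pow_eq hn hg hx
    rw [← pow_mul, ← Units.val_pow_eq_pow_val, ← Units.val_pow_eq_pow_val, Units.val_inj,
      pow_eq_pow_iff_modEq, orderOf_generator_eq hn hg] at h
    exact ((h.of_dvd (dvd_mul_right 4 n)).dvd_iff dvd_rfl).mpr (dvd_mul_left 4 l)
  · rintro ⟨l, rfl⟩
    exact ⟨(g : F) ^ l, pow_ne_zero _ g.ne_zero, by rw [← pow_mul, mul_comm]⟩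

theorem sum_erase_zero_eq_sum_generator_pow [DecidableEq F] {M : Type*} [AddCommMonoid M]
    (f : F → M) :
    ∑ y ∈ Finset.univ.erase 0, f y = ∑ k ∈ Finset.range (4 * n), f ((g : F) ^ k) := by
  symm
  refine Finset.sum_bij (fun k _ => (g : F) ^ k) ?_ ?_ ?_ ?_
  · intro k _
    simp
  · intro k hk l hl h
    exact generator_pow_inj hn hg (Finset.mem_range.mp hk) (Finset.mem_range.mp hl) h
  · intro y hy
    obtain ⟨k, hk, h⟩ := exists_generator_pow_eq hn hg (Finset.ne_of_mem_erase hy)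
    exact ⟨k, Finset.mem_range.mpr hk, h⟩
  · intro k _
    rfl

theorem sum_fourthPowers_eq_sum_generator_pow {M : Type*} [AddCommMonoid M] (f : F → M) :
    ∑ y ∈ fourthPowers F, f y = ∑ l ∈ Finset.range n, f ((g : F) ^ (4 * l)) := by
  symm
  refine Finset.sum_bij (fun l _ => (g : F) ^ (4 * l)) ?_ ?_ ?_ ?_
  · intro l _
    exact (generator_pow_mem_fourthPowers_iff hn hg).mpr (dvd_mul_right 4 l)
  · intro k hk l hl h
    rw [Finset.mem_range] at hk hl
    have := generator_pow_inj hn hg (by omega) (by omega) h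
    omega
  · intro y hy
    have hy0 : y ≠ 0 := by
      obtain ⟨x, hx, rfl⟩ := mem_fourthPowers.mp hy
      exact pow_ne_zero 4 hx
    obtain ⟨k, hk, rfl⟩ := exists_generator_pow_eq hn hg hy0
    obtain ⟨l, rfl⟩ := (generator_pow_mem_fourthPowers_iff hn hg).mp hy
    exact ⟨l, Finset.mem_range.mpr (by omega), rfl⟩
  · intro l _
    rfl

theorem card_fourthPowers : (fourthPowers F).card = n := by
  rw [Finset.card_eq_sum_ones, sum_fourthPowers_eq_sum_generator_pow hn hg]
  simp

/-- The fourth powers contain the prime field if `4 (p - 1)` divides `q - 1`. -/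
theorem natCast_mem_fourthPowers {p : ℕ} [Fact p.Prime] [CharP F p] (hpn : p - 1 ∣ n) {c : ℕ}
    (hc : (c : F) ≠ 0) : (c : F) ∈ fourthPowers F := by
  obtain ⟨k, hk, h⟩ := exists_generator_pow_eq hn hg hc
  have h1 : (c : F) ^ (p - 1) = 1 := by
    have h2 : (c : ZMod p) ≠ 0 := by
      intro h0
      apply hc
      rw [ZMod.natCast_eq_zero_iff] at h0
      exact (CharP.cast_eq_zero_iff F p c).mpr h0
    have h3 := congrArg (ZMod.castHom dvd_rfl F) (ZMod.pow_card_sub_one_eq_one h2)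
    simpa using h3
  obtain ⟨j, hj⟩ := hpn
  -- As `g` has order `4n`, this forces `4n ∣ kn`, that is `4 ∣ k`.
  have h4 : (g : F) ^ (k * n) = 1 := by
    rw [pow_mul, h, hj, pow_mul, h1, one_pow]
  rw [← Units.val_pow_eq_pow_val, Units.val_eq_one, ← orderOf_dvd_iff_pow_eq_one,
    orderOf_generator_eq hn hg] at h4
  rw [← h, generator_pow_mem_fourthPowers_iff hn hg]
  exact Nat.dvd_of_mul_dvd_mul_right (by omega) h4

/-- A Gauss sum of a character `χ` with `χ ^ 4 = 1` in terms of character sums over the fourth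
powers. -/
theorem gaussSum_eq_sum_fourthPowers (χ : MulChar F ℂ) (hχ : χ g ^ 4 = 1) (ψ : AddChar F ℂ) :
    gaussSum χ ψ = ∑ y ∈ fourthPowers F, ψ (1 * y) + χ g * ∑ y ∈ fourthPowers F, ψ (g * y)
      + χ g ^ 2 * ∑ y ∈ fourthPowers F, ψ ((g : F) ^ 2 * y)
      + χ g ^ 3 * ∑ y ∈ fourthPowers F, ψ ((g : F) ^ 3 * y) := by
  classical
  -- Exponents modulo 4 separate the four cosets of the fourth powers, on each of which `χ` is
  -- constant.
  rw [gaussSum, ← Finset.sum_erase_add _ _ (Finset.mem_univ (0 : F)),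
    sum_erase_zero_eq_sum_generator_pow hn hg, Finset.sum_range_four_mul]
  simp only [sum_fourthPowers_eq_sum_generator_pow hn hg, Finset.mul_sum, ← Finset.sum_add_distrib]
  rw [MulChar.map_zero, zero_mul, add_zero]
  refine Finset.sum_congr rfl fun l _ => ?_
  simp only [map_pow, map_mul, pow_add, pow_mul, hχ, one_pow, one_mul, pow_one]
  ring_nf

end Generator

/-! ### The quartic Jacobi sum modulo `p` -/

/-- The sum of the `i`-th powers over a finite field. -/
theorem sum_pow_of_pos {F : Type*} [Field F] [Fintype F] {n : ℕ}
    (hn : Fintype.card F = 4 * n + 1) {i : ℕ} (hi : 0 < i) :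
    ∑ x : F, x ^ i = if 4 * n ∣ i then -1 else 0 := by
  classical
  have h := FiniteField.sum_pow_units F i
  rw [hn, Nat.add_sub_cancel] at h
  rw [← h, ← Finset.sum_erase_add _ _ (Finset.mem_univ (0 : F)), zero_pow hi.ne', add_zero,
    Finset.sum_subtype (p := fun x : F => x ≠ 0) _ (by simp)]
  exact Fintype.sum_equiv unitsEquivNeZero.symm _ _ fun x => rfl

/-- The Jacobi sum of the character `x ↦ x ^ (3n)` of a field with `4n + 1` elements. -/
theorem sum_pow_mul_one_sub_pow {F : Type*} [Field F] [Fintype F] {n : ℕ}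
    (hn : Fintype.card F = 4 * n + 1) (hn0 : 0 < n) :
    ∑ x : F, x ^ (3 * n) * (1 - x) ^ (3 * n) = -((-1) ^ n * ((3 * n).choose n : F)) := by
  have h1 : ∀ x : F, x ^ (3 * n) * (1 - x) ^ (3 * n)
      = ∑ k ∈ Finset.range (3 * n + 1), (-1) ^ k * ((3 * n).choose k : F) * x ^ (3 * n + k) := by
    intro x
    rw [sub_eq_neg_add, add_pow, Finset.mul_sum]
    refine Finset.sum_congr rfl fun k _ => ?_
    rw [neg_pow, one_pow, pow_add]
    ring
  rw [Finset.sum_congr rfl fun x _ => h1 x, Finset.sum_comm]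
  simp_rw [← Finset.mul_sum]
  -- The exponents `3n + k` run from `3n` to `6n`, where `4n` is the only multiple of `4n`.
  rw [Finset.sum_eq_single n]
  · rw [sum_pow_of_pos hn (by omega), if_pos ⟨1, by ring⟩]
    ring
  · intro k hk hkn
    rw [Finset.mem_range] at hk
    rw [sum_pow_of_pos hn (by omega), if_neg, mul_zero]
    rintro ⟨j, hj⟩
    have hj1 : 0 < j := by
      rcases Nat.eq_zero_or_pos j with rfl | h
      · omega
      · exact h
    have hj2 : j < 2 := by
      by_contra! h
      have := Nat.mul_le_mul_left (4 * n) h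
      omega
    obtain rfl : j = 1 := by omega
    omega
  · intro h
    exact absurd (Finset.mem_range.mpr (by omega)) h

section Generator

variable {F : Type*} [Field F] [Fintype F] {n : ℕ} (hn : Fintype.card F = 4 * n + 1)
  {g : Fˣ} (hg : ∀ x, x ∈ Subgroup.zpowers g)

include hn hg

/-- There is a multiplicative character with values in `ℤ[i]` that maps a given generator to `i`. -/
theorem exists_mulChar_gaussianInt : ∃ χ : MulChar F GaussianInt, χ g = ⟨0, 1⟩ := by
  classical
  let I : GaussianIntˣ := ⟨⟨0, 1⟩, ⟨0, -1⟩, by ext <;> simp, by ext <;> simp⟩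
  have hI : I ∈ rootsOfUnity (Fintype.card Fˣ) GaussianInt := by
    rw [mem_rootsOfUnity, Fintype.card_units, hn, Nat.add_sub_cancel, pow_mul]
    have h4 : I ^ 4 = 1 := by
      ext <;> simp [I, pow_succ]
    rw [h4, one_pow]
  exact ⟨MulChar.ofRootOfUnity hI hg, MulChar.ofRootOfUnity_spec hI hg⟩

/-- The quartic Jacobi sum of a field of characteristic `p ≡ 1 (mod 4)` is not divisible by `p`. -/
theorem not_dvd_jacobiSum {p m : ℕ} (hp : p.Prime) [CharP F p] (hp1 : p % 4 = 1)
    (hq : Fintype.card F = p ^ m) (hn0 : 0 < n) (χ : MulChar F GaussianInt)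
    (hχ : χ g = ⟨0, 1⟩) :
    ¬ ((p : ℤ) ∣ (jacobiSum χ χ).re ∧ (p : ℤ) ∣ (jacobiSum χ χ).im) := by
  rintro ⟨hre, him⟩
  have hsq : (g : F) ^ (3 * n) * (g : F) ^ (3 * n) = ((-1 : ℤ) : F) := by
    rw [← pow_add, show 3 * n + 3 * n = 2 * n * 3 by ring, pow_mul, generator_pow_two_mul hn hg hn0]
    norm_num
  -- Reduction modulo a prime above `p`, realised by sending `i` to a square root of -1 in `F`. It
  -- turns `χ` into `x ↦ x ^ (3n)`.
  let φ : GaussianInt →+* F := Zsqrtd.lift ⟨(g : F) ^ (3 * n), hsq⟩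
  have hφ : ∀ z : GaussianInt, φ z = (z.re : F) + (z.im : F) * (g : F) ^ (3 * n) := fun z => rfl
  have hval : ∀ x : F, χ.ringHomComp φ x = x ^ (3 * n) := by
    intro x
    by_cases hx : x = 0
    · rw [hx, MulChar.map_zero, zero_pow (by omega)]
    · obtain ⟨k, _, rfl⟩ := exists_generator_pow_eq hn hg hx
      rw [map_pow, MulChar.ringHomComp_apply, hχ, hφ]
      simp only [Int.cast_zero, Int.cast_one, zero_add, one_mul]
      rw [← pow_mul, ← pow_mul, mul_comm k]
  have hJ : φ (jacobiSum χ χ) = -((-1) ^ n * ((3 * n).choose n : F)) := by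
    rw [← jacobiSum_ringHomComp, jacobiSum, ← sum_pow_mul_one_sub_pow hn hn0]
    simp only [hval]
  rw [← CharP.intCast_eq_zero_iff F p] at hre him
  rw [hφ, hre, him, zero_mul, zero_add, eq_comm, neg_eq_zero] at hJ
  have hch : ((3 * n).choose n : F) = 0 :=
    (mul_eq_zero.mp hJ).resolve_left (pow_ne_zero _ (neg_ne_zero.mpr one_ne_zero))
  rw [CharP.cast_eq_zero_iff F p] at hch
  exact not_dvd_choose_three_mul hp (b := p / 4) (by omega) m n (hn ▸ hq) hch

/-! ### Quartic periods and their relations -/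

/-- The quartic periods of a finite field of characteristic `p` with `q = 4n + 1` elements, in the
case that they are integers, and the relations that the Gauss and Jacobi sums of the quartic
characters impose on them. -/
theorem exists_quartic_periods {p m : ℕ} (hp : p.Prime) [CharP F p]
    (hq : Fintype.card F = p ^ m) (hn0 : 0 < n) (hpn : p - 1 ∣ n)
    {ψ : AddChar F ℂ} (hψ : ψ.IsPrimitive) :
    ∃ e : ℕ → ℤ, (∀ k, ∑ y ∈ fourthPowers F, ψ ((g : F) ^ k * y) = e k) ∧
      (∀ k, e (k + 4) = e k) ∧
      e 0 + e 1 + e 2 + e 3 = -1 ∧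
      (e 0 - e 1 + e 2 - e 3) ^ 2 = (p : ℤ) ^ m ∧
      (e 0 - e 2) ^ 2 + (e 1 - e 3) ^ 2 = (p : ℤ) ^ m ∧
      (p % 4 = 1 → ∃ x y : ℤ,
        (e 0 - e 2) ^ 2 - (e 1 - e 3) ^ 2 = (e 0 - e 1 + e 2 - e 3) * x ∧
        2 * (e 0 - e 2) * (e 1 - e 3) = (e 0 - e 1 + e 2 - e 3) * y ∧
        ¬ ((p : ℤ) ∣ x ∧ (p : ℤ) ∣ y)) := by
  classical
  have : Fact p.Prime := ⟨hp⟩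
  have hstable : ∀ c : ℕ, (c : F) ≠ 0 → ∀ y ∈ fourthPowers F, (c : F) * y ∈ fourthPowers F := by
    intro c hc y hy
    obtain ⟨k, _, hk⟩ := exists_generator_pow_eq hn hg hc
    have hy0 : y ≠ 0 := by
      obtain ⟨x, hx, rfl⟩ := mem_fourthPowers.mp hy
      exact pow_ne_zero 4 hx
    obtain ⟨l, _, rfl⟩ := exists_generator_pow_eq hn hg hy0
    have hc' := natCast_mem_fourthPowers hn hg hpn hc
    rw [← hk] at hc' ⊢
    rw [generator_pow_mem_fourthPowers_iff hn hg] at hc' hy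
    rw [← pow_add, generator_pow_mem_fourthPowers_iff hn hg]
    exact dvd_add hc' hy
  choose e he using fun k : ℕ => exists_int_eq_charSum hp ψ (fourthPowers F) hstable ((g : F) ^ k)
  have hgauss : ∀ χ : MulChar F ℂ, χ g ^ 4 = 1 → gaussSum χ ψ
      = e 0 + χ g * e 1 + χ g ^ 2 * e 2 + χ g ^ 3 * e 3 := by
    intro χ hχ
    have h0 := he 0
    have h1 := he 1
    rw [pow_zero] at h0
    rw [pow_one] at h1
    rw [gaussSum_eq_sum_fourthPowers hn hg χ hχ, h0, h1, he, he]
  -- Values in `ℤ[i]` ensure that the Jacobi sum has integral real and imaginary parts, which become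
  -- `x` and `y`.
  obtain ⟨χ₀, hχ₀⟩ := exists_mulChar_gaussianInt hn hg
  set χ : MulChar F ℂ := χ₀.ringHomComp GaussianInt.toComplex with hχdef
  have hχ : χ g = Complex.I := by
    rw [hχdef, MulChar.ringHomComp_apply, hχ₀, GaussianInt.toComplex_def]
    simp
  have hχχ : (χ * χ) g = -1 := by
    rw [MulChar.mul_apply, hχ, Complex.I_mul_I]
  have hχχ1 : χ * χ ≠ 1 := by
    intro h
    rw [h, MulChar.one_apply_coe] at hχχ
    norm_num at hχχ
  have hχ1 : χ ≠ 1 := by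
    intro h
    rw [h, one_mul] at hχχ1
    exact hχχ1 rfl
  have hG : gaussSum χ ψ = (e 0 - e 2 : ℤ) + (e 1 - e 3 : ℤ) * Complex.I := by
    rw [hgauss χ (by rw [hχ, Complex.I_pow_four]), hχ, Complex.I_sq, Complex.I_pow_three]
    push_cast
    ring
  have hG2 : gaussSum (χ * χ) ψ = (e 0 - e 1 + e 2 - e 3 : ℤ) := by
    rw [hgauss _ (by rw [hχχ]; norm_num), hχχ]
    push_cast
    ring
  refine ⟨e, he, ?_, ?_, ?_, ?_, ?_⟩
  · intro k
    have h : ∑ y ∈ fourthPowers F, ψ ((g : F) ^ (k + 4) * y)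
        = ∑ y ∈ fourthPowers F, ψ ((g : F) ^ k * y) := by
      have hg4 : (g : F) ^ 4 ∈ fourthPowers F :=
        (generator_pow_mem_fourthPowers_iff hn hg).mpr dvd_rfl
      have himg : (fourthPowers F).image (fun y => (g : F) ^ 4 * y) = fourthPowers F := by
        refine Finset.eq_of_subset_of_card_le ?_ ?_
        · intro y hy
          obtain ⟨x, hx, rfl⟩ := Finset.mem_image.mp hy
          obtain ⟨z, hz, rfl⟩ := mem_fourthPowers.mp hx
          exact mem_fourthPowers.mpr ⟨g * z, mul_ne_zero g.ne_zero hz, (mul_pow _ _ _).symm⟩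
        · rw [Finset.card_image_of_injective _
            (mul_right_injective₀ (pow_ne_zero 4 g.ne_zero))]
      conv_rhs => rw [← himg]
      rw [Finset.sum_image fun x _ y _ h =>
        mul_right_injective₀ (pow_ne_zero 4 g.ne_zero) h]
      refine Finset.sum_congr rfl fun y _ => ?_
      congr 1
      ring
    rw [he, he] at h
    exact_mod_cast h
  · have h := hgauss 1 (by rw [MulChar.one_apply_coe, one_pow])
    have hψ1 : ψ ≠ 1 := by
      have h1 := hψ one_ne_zero
      rwa [AddChar.mulShift_one] at h1
    rw [gaussSum_one_left hψ1, MulChar.one_apply_coe] at h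
    have : ((e 0 + e 1 + e 2 + e 3 : ℤ) : ℂ) = (-1 : ℤ) := by
      push_cast
      linear_combination -h
    exact_mod_cast this
  · have hquad : (χ * χ).IsQuadratic := by
      intro x
      by_cases hx : x = 0
      · left
        rw [hx, MulChar.map_zero]
      · obtain ⟨k, _, rfl⟩ := exists_generator_pow_eq hn hg hx
        rw [map_pow, hχχ]
        right
        exact neg_one_pow_eq_or ℂ k
    -- The sign `χ²(-1)` is 1, because `-1 = g ^ (2n)` is an even power of `g`.
    have h := gaussSum_sq hχχ1 hquad hψ
    rw [← generator_pow_two_mul hn hg hn0, map_pow, hχχ, pow_mul, neg_one_sq, one_pow, one_mul,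
      hG2, hq] at h
    exact_mod_cast h
  · have h := gaussSum_mul_gaussSum_eq_card hχ1 hψ
    rw [← star_gaussSum_eq, hG, hq, Complex.star_def, Complex.mul_conj,
      ← Complex.ofReal_intCast, ← Complex.ofReal_intCast, Complex.normSq_add_mul_I] at h
    exact_mod_cast h
  · intro hp1
    refine ⟨(jacobiSum χ₀ χ₀).re, (jacobiSum χ₀ χ₀).im, ?_, ?_,
      not_dvd_jacobiSum hn hg hp hp1 hq hn0 χ₀ hχ₀⟩
    all_goals
      have h := jacobiSum_mul_nontrivial hχχ1 ψ
      rw [hG, hG2, jacobiSum_ringHomComp, GaussianInt.toComplex_def] at h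
    · have h' := congrArg Complex.re h
      simp only [← Complex.ofReal_intCast] at h'
      simp [-GaussianInt.intCast_re, -GaussianInt.intCast_im] at h'
      rw [sq, sq]
      exact_mod_cast h'.symm
    · have h' := congrArg Complex.im h
      simp only [← Complex.ofReal_intCast] at h'
      simp [-GaussianInt.intCast_re, -GaussianInt.intCast_im] at h'
      have h2 : (e 0 - e 1 + e 2 - e 3) * (jacobiSum χ₀ χ₀).im
          = (e 0 - e 2) * (e 1 - e 3) + (e 1 - e 3) * (e 0 - e 2) := by
        exact_mod_cast h'
      rw [h2]
      ring

end Generator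

/-! ### The spectrum in terms of the periods -/

/-- The Cayley graph as a simple graph symmetrises its connection set and drops loops. Neither
changes anything here: the fourth powers are closed under negation and omit 0. -/
theorem genPaley_four_adj_iff {F : Type*} [Field F] [Fintype F]
    (hneg : (-1 : F) ∈ fourthPowers F) (v w : F) :
    (genPaley 4 F).Adj v w ↔ w - v ∈ fourthPowers F := by
  have hne : ∀ y ∈ fourthPowers F, y ≠ 0 := by
    intro y hy
    obtain ⟨x, hx, rfl⟩ := mem_fourthPowers.mp hy
    exact pow_ne_zero 4 hx
  have hsymm : ∀ y ∈ fourthPowers F, -y ∈ fourthPowers F := by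
    intro y hy
    obtain ⟨x, hx, rfl⟩ := mem_fourthPowers.mp hy
    obtain ⟨i, hi, hi'⟩ := mem_fourthPowers.mp hneg
    exact mem_fourthPowers.mpr ⟨i * x, mul_ne_zero hi hx, by rw [mul_pow, ← hi', neg_one_mul]⟩
  rw [genPaley, SimpleGraph.addCayley_adj']
  constructor
  · rintro ⟨_, y, hy, rfl | rfl⟩
    · simpa using mem_fourthPowers.mpr hy
    · simpa using hsymm _ (mem_fourthPowers.mpr hy)
  · intro h
    exact ⟨fun hvw => hne _ h (by rw [hvw, sub_self]), w - v, mem_fourthPowers.mp h,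
      Or.inl (add_sub_cancel v w)⟩

theorem periodic_eq_of_period_four {M : Type*} {e : ℕ → M} (h : ∀ k, e (k + 4) = e k) (l k : ℕ) :
    e (k + 4 * l) = e k := by
  induction l with
  | zero => rfl
  | succ l ih => exact (h _).trans ih

/-- The spectrum of the generalized Paley graph in terms of the quartic periods. -/
theorem graphSpectrum_genPaley_four {F : Type*} [Field F] [Fintype F] {n : ℕ}
    (hn : Fintype.card F = 4 * n + 1) {g : Fˣ} (hg : ∀ x, x ∈ Subgroup.zpowers g)
    (hneg : (-1 : F) ∈ fourthPowers F) {ψ : AddChar F ℂ} (hψ : ψ.IsPrimitive) {e : ℕ → ℤ}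
    (he : ∀ k, ∑ y ∈ fourthPowers F, ψ ((g : F) ^ k * y) = e k) (he4 : ∀ k, e (k + 4) = e k) :
    graphSpectrum (genPaley 4 F) = {(n : ℝ)} + ((Multiset.replicate n (e 0 : ℝ)
      + Multiset.replicate n (e 2 : ℝ))
      + (Multiset.replicate n (e 1 : ℝ) + Multiset.replicate n (e 3 : ℝ))) := by
  classical
  set E : F → ℝ := fun a => (∑ y ∈ fourthPowers F, ψ (a * y)).re with hE
  have hE0 : ∑ y ∈ fourthPowers F, ψ ((0 : F) * y) = (n : ℂ) := by
    simp [card_fourthPowers hn hg]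
  have hEn : E 0 = n := by
    rw [hE]
    change (∑ y ∈ fourthPowers F, ψ ((0 : F) * y)).re = n
    rw [hE0, Complex.natCast_re]
  have hEg : ∀ k, E ((g : F) ^ k) = e k := by
    intro k
    change (∑ y ∈ fourthPowers F, ψ ((g : F) ^ k * y)).re = e k
    rw [he, Complex.intCast_re]
  have hsum : ∀ a, ∑ y ∈ fourthPowers F, ψ (a * y) = (E a : ℂ) := by
    intro a
    by_cases ha : a = 0
    · rw [ha, hEn, hE0, Complex.ofReal_natCast]
    · obtain ⟨k, _, rfl⟩ := exists_generator_pow_eq hn hg ha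
      rw [hEg, he, Complex.ofReal_intCast]
  have hspec : graphSpectrum (genPaley 4 F) = ∑ a : F, {E a} := by
    rw [graphSpectrum, charpoly_adjMatrix_of_charSum hψ _ (fourthPowers F)
      (genPaley_four_adj_iff hneg) E hsum]
    have h1 := Polynomial.roots_multiset_prod_X_sub_C (Finset.univ.val.map E)
    have h2 := Multiset.sum_map_singleton (Finset.univ.val.map E)
    rw [Multiset.map_map] at h1 h2
    exact h1.trans h2.symm
  rw [hspec, ← Finset.sum_erase_add _ _ (Finset.mem_univ (0 : F)),
    sum_erase_zero_eq_sum_generator_pow hn hg, Finset.sum_range_four_mul, hEn, add_comm]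
  congr 1
  -- Each block of four consecutive exponents contributes every period once.
  have hl : ∀ l ∈ Finset.range n, ({E ((g : F) ^ (4 * l))} + {E ((g : F) ^ (4 * l + 1))}
      + {E ((g : F) ^ (4 * l + 2))} + {E ((g : F) ^ (4 * l + 3))} : Multiset ℝ)
      = {(e 0 : ℝ)} + {(e 1 : ℝ)} + {(e 2 : ℝ)} + {(e 3 : ℝ)} := by
    intro l _
    have h0 := periodic_eq_of_period_four he4 l 0
    rw [zero_add] at h0
    rw [hEg, hEg, hEg, hEg, h0, add_comm _ 1, add_comm _ 2, add_comm _ 3,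
      periodic_eq_of_period_four he4, periodic_eq_of_period_four he4,
      periodic_eq_of_period_four he4]
  rw [Finset.sum_congr rfl hl, Finset.sum_const, Finset.card_range]
  simp only [nsmul_add, Multiset.nsmul_singleton]
  abel

/-- Both pairs are the roots of one quadratic. This suits the periods, which are known only up to
exchange within a pair. -/
theorem Multiset.replicate_add_replicate_eq_of_sum_eq_of_prod_eq {R : Type*} [CommRing R]
    [IsDomain R] {x y a b : R} (hs : x + y = a + b) (hp : x * y = a * b) (n : ℕ) :
    Multiset.replicate n x + Multiset.replicate n y
      = Multiset.replicate n a + Multiset.replicate n b := by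
  have h : (x - a) * (x - b) = 0 := by linear_combination x * hs - hp
  rcases mul_eq_zero.mp h with h | h
  · obtain rfl := sub_eq_zero.mp h
    rw [add_left_cancel hs]
  · obtain rfl := sub_eq_zero.mp h
    rw [add_comm a x] at hs
    rw [add_left_cancel hs, add_comm]

/-! ### Separating the eigenvalues -/

/-- The nontrivial eigenvalues are smaller than the degree. -/
theorem add_two_mul_ne_of_sq_eq {G u q : ℤ} (hG : G ^ 2 = q) (hu : u ^ 2 ≤ q) (hq5 : 5 ≤ q)
    (hq9 : q ≠ 9) : G + 2 * u ≠ q := by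
  intro h
  -- If `q = G + 2u`, then `|G|² = q ≤ 3|G|`, so `|G| ≤ 3` and `q` is 0, 1, 4 or 9.
  have hu' : u ≤ |G| := (le_abs_self u).trans (sq_le_sq.mp (hG ▸ hu))
  have hGa : |G| ^ 2 = q := by rw [sq_abs, hG]
  have hGl := le_abs_self G
  have h3 : |G| ≤ 3 := by
    by_contra! h4
    nlinarith
  have h0 := abs_nonneg G
  generalize |G| = a at *
  interval_cases a <;> omega

/-- All differences are multiples of `r`. The degree is too large, since `|c|` and `|2d|` are at
most `r`. A coincidence between the two types means `r = ±c ± 2d`; squaring gives `cd = 0`. -/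
theorem nodup_quartic_values {r c d : ℝ} (h : r ^ 2 = c ^ 2 + 4 * d ^ 2) (hc : c ≠ 0) (hd : d ≠ 0)
    (hr : 2 < r) :
    [(r ^ 4 - 1) / 4, (r ^ 2 + 4 * d * r - 1) / 4, (r ^ 2 - 4 * d * r - 1) / 4,
      (-r ^ 2 + 2 * c * r - 1) / 4, (-r ^ 2 - 2 * c * r - 1) / 4].Nodup := by
  have hr0 : r ≠ 0 := by positivity
  have hcd : c * d ≠ 0 := mul_ne_zero hc hd
  have hd2 : |2 * d| ≤ r := abs_le_of_sq_le_sq (by nlinarith [sq_nonneg c]) (by linarith)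
  have hc2 : |c| ≤ r := abs_le_of_sq_le_sq (by nlinarith [sq_nonneg d]) (by linarith)
  rw [abs_le] at hd2 hc2
  have hr3 : 4 * r < r ^ 3 := by nlinarith [mul_pos (by linarith : 0 < r) (by nlinarith : 0 < r ^ 2 - 4)]
  have key : ∀ a : ℝ, a * r = 0 → a = 0 := fun a ha => (mul_eq_zero.mp ha).resolve_right hr0
  simp only [List.nodup_cons, List.mem_cons, List.not_mem_nil, or_false, not_or, List.nodup_nil,
    and_true, not_false_eq_true]
  refine ⟨⟨?_, ?_, ?_, ?_⟩, ⟨?_, ?_, ?_⟩, ⟨?_, ?_⟩, ?_⟩ <;> intro he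
  · have := key (r ^ 3 - r - 4 * d) (by linear_combination 4 * he)
    linarith
  · have := key (r ^ 3 - r + 4 * d) (by linear_combination 4 * he)
    linarith
  · have := key (r ^ 3 + r - 2 * c) (by linear_combination 4 * he)
    linarith
  · have := key (r ^ 3 + r + 2 * c) (by linear_combination 4 * he)
    linarith
  · exact hd (key d (by linear_combination he / 2))
  · have := key (r + 2 * d - c) (by linear_combination 2 * he)
    exact hcd (by linear_combination ((r + c - 2 * d) * this - h) / 4)
  · have := key (r + 2 * d + c) (by linear_combination 2 * he)
    exact hcd (by linear_combination (h - (r - c - 2 * d) * this) / 4)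
  · have := key (r - 2 * d - c) (by linear_combination 2 * he)
    exact hcd (by linear_combination (h - (r + c + 2 * d) * this) / 4)
  · have := key (r - 2 * d + c) (by linear_combination 2 * he)
    exact hcd (by linear_combination ((r - c + 2 * d) * this - h) / 4)
  · exact hc (key c (by linear_combination he))

theorem List.nodup_triple_of_ne {a b c : ℝ} (h1 : a ≠ b) (h2 : a ≠ c) (h3 : b ≠ c) :
    [a, b, c].Nodup := by
  simp [h1, h2, h3]

/-! ### Solving for the periods -/

/-- In the semiprimitive case three of the quartic periods agree. -/
theorem semiprimitive_periods {e0 e1 e2 e3 ρ : ℤ} (hs : e0 + e1 + e2 + e3 = -1)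
    (hG : (e0 - e1 + e2 - e3) ^ 2 = ρ ^ 2) (hN : (e0 - e2) ^ 2 + (e1 - e3) ^ 2 = ρ ^ 2)
    (h0 : e0 - e2 = 0 ∨ e1 - e3 = 0) (hρ : ρ % 4 = 1) :
    ((4 * e0 + 1 = ρ ∧ 4 * e2 + 1 = ρ) ∧
      ((4 * e1 + 1 = ρ ∧ 4 * e3 + 1 = -3 * ρ) ∨ (4 * e1 + 1 = -3 * ρ ∧ 4 * e3 + 1 = ρ))) ∨
    ((4 * e1 + 1 = ρ ∧ 4 * e3 + 1 = ρ) ∧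
      ((4 * e0 + 1 = ρ ∧ 4 * e2 + 1 = -3 * ρ) ∨ (4 * e0 + 1 = -3 * ρ ∧ 4 * e2 + 1 = ρ))) := by
  -- For the equal pair `4e + 1` is `±ρ`, and `ρ ≡ 1 (mod 4)` excludes the minus sign. This fixes
  -- the alternating sum; the other difference is `±ρ`.
  rcases h0 with h | h <;> rw [h] at hN <;> norm_num at hN <;>
    rcases sq_eq_sq_iff_eq_or_eq_neg.mp hG with h1 | h1 <;>
    rcases sq_eq_sq_iff_eq_or_eq_neg.mp hN with h2 | h2 <;> omega

theorem isQuarticPair_iff {p t : ℕ} {c d : ℤ} : IsQuarticPair p (p ^ (4 * t)) c d ↔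
    c ^ 2 + 4 * d ^ 2 = (p : ℤ) ^ (2 * t) ∧ c ≡ 1 [ZMOD 4] ∧ IsCoprime c (p : ℤ) := by
  have h : √((p ^ (4 * t) : ℕ) : ℝ) = (p : ℝ) ^ (2 * t) := by
    rw [Real.sqrt_eq_iff_mul_self_eq (by positivity) (by positivity), ← pow_add]
    push_cast
    congr 1
    ring
  rw [IsQuarticPair, h]
  refine and_congr_left fun _ => ?_
  rw [eq_comm]
  constructor
  · intro h1
    exact_mod_cast h1
  · intro h1
    exact_mod_cast h1

theorem rpow_quarter_pow_four_mul {x : ℝ} (hx : 0 ≤ x) (t : ℕ) :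
    (x ^ (4 * t)) ^ (1 / 4 : ℝ) = x ^ t := by
  rw [mul_comm, pow_mul, one_div]
  exact_mod_cast Real.pow_rpow_inv_natCast (pow_nonneg hx t) four_ne_zero

/-- The quartic periods for `p ≡ 1 (mod 4)`, with `√q = r² = c² + 4d²`. -/
theorem exists_quartic_pair_periods {p t : ℕ} (hp : p.Prime) (hp1 : p % 4 = 1) (ht : t ≠ 0)
    {e0 e1 e2 e3 : ℤ} (hs : e0 + e1 + e2 + e3 = -1)
    (hG : (e0 - e1 + e2 - e3) ^ 2 = (p : ℤ) ^ (4 * t))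
    (hN : (e0 - e2) ^ 2 + (e1 - e3) ^ 2 = (p : ℤ) ^ (4 * t))
    (hJ : ∃ x y : ℤ, (e0 - e2) ^ 2 - (e1 - e3) ^ 2 = (e0 - e1 + e2 - e3) * x ∧
        2 * (e0 - e2) * (e1 - e3) = (e0 - e1 + e2 - e3) * y ∧
        ¬ ((p : ℤ) ∣ x ∧ (p : ℤ) ∣ y)) :
    ∃ c d : ℤ, (c ^ 2 + 4 * d ^ 2 = (p : ℤ) ^ (2 * t) ∧ c ≡ 1 [ZMOD 4] ∧ IsCoprime c (p : ℤ)) ∧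
      ((4 * (e0 + e2) = -2 * ((p : ℤ) ^ t) ^ 2 - 2 ∧ (e0 - e2) ^ 2 = c ^ 2 * ((p : ℤ) ^ t) ^ 2 ∧
        4 * (e1 + e3) = 2 * ((p : ℤ) ^ t) ^ 2 - 2 ∧
        (e1 - e3) ^ 2 = 4 * d ^ 2 * ((p : ℤ) ^ t) ^ 2) ∨
      (4 * (e1 + e3) = -2 * ((p : ℤ) ^ t) ^ 2 - 2 ∧ (e1 - e3) ^ 2 = c ^ 2 * ((p : ℤ) ^ t) ^ 2 ∧
        4 * (e0 + e2) = 2 * ((p : ℤ) ^ t) ^ 2 - 2 ∧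
        (e0 - e2) ^ 2 = 4 * d ^ 2 * ((p : ℤ) ^ t) ^ 2)) := by
  have hp2 : p ≠ 2 := by omega
  obtain ⟨x, y, hx, hy, hxy⟩ := hJ
  obtain ⟨u, v, hu, hv, huv, hup, hvp⟩ :=
    exists_primitive_part_of_sq_eq hp hp2 ht hN hG hx hy hxy
  have hP : (p : ℤ) ^ (4 * t) = (((p : ℤ) ^ t) ^ 2) ^ 2 := by
    rw [← pow_mul, ← pow_mul]; congr 1; ring
  have hP2 : (p : ℤ) ^ (2 * t) = ((p : ℤ) ^ t) ^ 2 := by rw [← pow_mul, mul_comm]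
  have hr4 : (p : ℤ) ^ t ≡ 1 [ZMOD 4] := by
    have h1 : (p : ℤ) ≡ 1 [ZMOD 4] := by rw [Int.ModEq]; omega
    simpa using h1.pow t
  rw [hP] at hG
  rw [hP2] at huv ⊢
  generalize (p : ℤ) ^ t = r at *
  have hrsq : r ^ 2 % 4 = 1 := by simpa [Int.ModEq] using hr4.pow 2
  have hsign : ∀ c : ℤ, c % 2 = 1 → IsCoprime c (p : ℤ) →
      ∃ c' : ℤ, c' ^ 2 = c ^ 2 ∧ c' ≡ 1 [ZMOD 4] ∧ IsCoprime c' (p : ℤ) := by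
    intro c hc hcp
    have h4 : c % 4 = 1 ∨ c % 4 = 3 := by omega
    rcases h4 with h4 | h4
    · exact ⟨c, rfl, h4, hcp⟩
    · exact ⟨-c, neg_sq c, by rw [Int.ModEq]; omega, hcp.neg_left⟩
  have hmul : ∀ w : ℤ, (r * w) % 2 = w % 2 := by
    intro w
    have h1 : r % 2 = 1 := by rw [Int.ModEq] at hr4; omega
    rw [Int.mul_emod, h1, one_mul, Int.emod_emod]
  have hmu := hmul u
  have hmv := hmul v
  rw [← hu] at hmu
  rw [← hv] at hmv
  -- The sign of the quadratic Gauss sum decides which of `u`, `v` is odd: `e0 + e2` and `e1 + e3`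
  -- are `(±r² - 1)/2` with opposite signs, and a sum has the parity of the difference.
  rcases sq_eq_sq_iff_eq_or_eq_neg.mp hG with h1 | h1
  · have hv1 : v % 2 = 1 := by omega
    obtain ⟨d, rfl⟩ : ∃ d, u = 2 * d := ⟨u / 2, by omega⟩
    obtain ⟨c, hc, hc4, hcp⟩ := hsign v hv1 hvp
    refine ⟨c, d, ⟨by rw [hc]; linear_combination huv, hc4, hcp⟩, Or.inr ⟨?_, ?_, ?_, ?_⟩⟩
    · linear_combination 2 * hs - 2 * h1
    · rw [hc, hv]; ring
    · linear_combination 2 * hs + 2 * h1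
    · rw [hu]; ring
  · have hu1 : u % 2 = 1 := by omega
    obtain ⟨d, rfl⟩ : ∃ d, v = 2 * d := ⟨v / 2, by omega⟩
    obtain ⟨c, hc, hc4, hcp⟩ := hsign u hu1 hup
    refine ⟨c, d, ⟨by rw [hc]; linear_combination huv, hc4, hcp⟩, Or.inl ⟨?_, ?_, ?_, ?_⟩⟩
    · linear_combination 2 * hs + 2 * h1
    · rw [hc, hu]; ring
    · linear_combination 2 * hs - 2 * h1
    · rw [hv]; ring

/-- Two periods with given sum and given squared difference, as a multiset. -/
theorem replicate_periods_eq {x y : ℤ} {S D : ℝ} (hS : 4 * ((x : ℝ) + y) = 2 * S)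
    (hD : ((x : ℝ) - y) ^ 2 = (D / 2) ^ 2) (n : ℕ) :
    Multiset.replicate n (x : ℝ) + Multiset.replicate n (y : ℝ)
      = Multiset.replicate n ((S + D) / 4) + Multiset.replicate n ((S - D) / 4) := by
  apply Multiset.replicate_add_replicate_eq_of_sum_eq_of_prod_eq
  · linear_combination hS / 4
  · linear_combination ((x : ℝ) + y + S / 2) * hS / 16 - hD / 4

theorem replicate_semiprimitive_periods {e0 e1 e2 e3 ρ : ℤ} (n : ℕ)
    (h : ((4 * e0 + 1 = ρ ∧ 4 * e2 + 1 = ρ) ∧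
      ((4 * e1 + 1 = ρ ∧ 4 * e3 + 1 = -3 * ρ) ∨ (4 * e1 + 1 = -3 * ρ ∧ 4 * e3 + 1 = ρ))) ∨
    ((4 * e1 + 1 = ρ ∧ 4 * e3 + 1 = ρ) ∧
      ((4 * e0 + 1 = ρ ∧ 4 * e2 + 1 = -3 * ρ) ∨ (4 * e0 + 1 = -3 * ρ ∧ 4 * e2 + 1 = ρ)))) :
    (Multiset.replicate n (e0 : ℝ) + Multiset.replicate n (e2 : ℝ))
      + (Multiset.replicate n (e1 : ℝ) + Multiset.replicate n (e3 : ℝ))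
      = Multiset.replicate (3 * n) (((ρ : ℝ) - 1) / 4)
        + Multiset.replicate n ((-3 * (ρ : ℝ) - 1) / 4) := by
  have key : ∀ e s : ℤ, 4 * e + 1 = s → (e : ℝ) = ((s : ℝ) - 1) / 4 := by
    rintro e s rfl
    push_cast
    ring
  have h3 : -3 * (ρ : ℝ) = ((-3 * ρ : ℤ) : ℝ) := by push_cast; ring
  rw [h3, show 3 * n = n + n + n by ring, Multiset.replicate_add, Multiset.replicate_add]
  rcases h with ⟨⟨h0, h2⟩, ⟨h1, h3⟩ | ⟨h1, h3⟩⟩ | ⟨⟨h0, h2⟩, ⟨h1, h3⟩ | ⟨h1, h3⟩⟩ <;>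
    (rw [key _ _ h0, key _ _ h1, key _ _ h2, key _ _ h3]; abel)

/-! ### Divisibility of the exponent -/

/-- The quotient `(p ^ m - 1) / (p - 1)` is congruent to `m` modulo `4` if `p ≡ 1 (mod 4)`. -/
theorem four_dvd_of_four_dvd_div {p m : ℕ} (hp : 2 ≤ p) (hp1 : p % 4 = 1)
    (h : 4 ∣ (p ^ m - 1) / (p - 1)) : 4 ∣ m := by
  rw [← Nat.geomSum_eq hp] at h
  have h1 : ∑ k ∈ Finset.range m, p ^ k ≡ ∑ k ∈ Finset.range m, 1 [MOD 4] :=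
    Nat.ModEq.sum fun k _ => by
      have h2 : p ≡ 1 [MOD 4] := hp1
      simpa using h2.pow k
  simp only [Finset.sum_const, Finset.card_range, smul_eq_mul, mul_one] at h1
  exact (h1.dvd_iff dvd_rfl).mp h

theorem two_dvd_of_four_dvd_div {p m : ℕ} (hp : 2 ≤ p) (hp1 : p % 2 = 1)
    (h : 4 ∣ (p ^ m - 1) / (p - 1)) : 2 ∣ m := by
  rw [← Nat.geomSum_eq hp] at h
  have h1 : ∑ k ∈ Finset.range m, p ^ k ≡ ∑ k ∈ Finset.range m, 1 [MOD 2] :=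
    Nat.ModEq.sum fun k _ => by
      have h2 : p ≡ 1 [MOD 2] := hp1
      simpa using h2.pow k
  simp only [Finset.sum_const, Finset.card_range, smul_eq_mul, mul_one] at h1
  exact (h1.dvd_iff dvd_rfl).mp ((by norm_num : 2 ∣ 4).trans h)

/-! ### The main theorem -/

theorem theorem2p3 (p m q n : ℕ) (hp : p.Prime) (hq : q = p ^ m)
    (hdvd : 4 ∣ (q - 1) / (p - 1)) (hq5 : 5 ≤ q) (hq9 : q ≠ 9) (hn : n = (q - 1) / 4)
    (F : Type*) [Field F] [Fintype F] (hF : Fintype.card F = q) :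
    (∀ v w : F, (genPaley 4 F).Adj v w ↔ w - v ∈ nonzeroPowers 4 F) ∧
    (genPaley 4 F).Connected ∧
    HasIntegralSpectrum (genPaley 4 F) ∧
    (p ≡ 1 [MOD 4] →
      (∃ t : ℕ, m = 4 * t) ∧
      (∃ c d : ℤ, IsQuarticPair p q c d) ∧
      (∀ c d c' d' : ℤ, IsQuarticPair p q c d → IsQuarticPair p q c' d' →
        c' = c ∧ (d' = d ∨ d' = -d)) ∧
      ∀ c d : ℤ, IsQuarticPair p q c d →
        HasSpec (genPaley 4 F)
          [((n : ℝ), 1),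
           ((√(q : ℝ) + 4 * (d : ℝ) * (q : ℝ) ^ (1 / 4 : ℝ) - 1) / 4, n),
           ((√(q : ℝ) - 4 * (d : ℝ) * (q : ℝ) ^ (1 / 4 : ℝ) - 1) / 4, n),
           ((-√(q : ℝ) + 2 * (c : ℝ) * (q : ℝ) ^ (1 / 4 : ℝ) - 1) / 4, n),
           ((-√(q : ℝ) - 2 * (c : ℝ) * (q : ℝ) ^ (1 / 4 : ℝ) - 1) / 4, n)]) ∧
    (p ≡ 3 [MOD 4] →
      (∃ t : ℕ, m = 2 * t) ∧
      (m ≡ 0 [MOD 4] →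
        HasSpec (genPaley 4 F)
          [((n : ℝ), 1), ((√(q : ℝ) - 1) / 4, 3 * n), ((-3 * √(q : ℝ) - 1) / 4, n)]) ∧
      (m ≡ 2 [MOD 4] →
        HasSpec (genPaley 4 F)
          [((n : ℝ), 1), ((3 * √(q : ℝ) - 1) / 4, n), ((-√(q : ℝ) - 1) / 4, 3 * n)]) ∧
      IsStronglyRegular (genPaley 4 F)) := by
  classical
  have : Fact p.Prime := ⟨hp⟩
  have hcard : Fintype.card F = p ^ m := hF.trans hq
  have hm0 : m ≠ 0 := by
    rintro rfl
    rw [hq, pow_zero] at hq5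
    omega
  have hchar : CharP F p := by
    obtain ⟨r, hr⟩ := CharP.exists F
    obtain ⟨k, hrp, hk⟩ := FiniteField.card F r
    have hpr : p = r := by
      have h1 : p ∣ r ^ (k : ℕ) := hk ▸ hcard ▸ dvd_pow_self p hm0
      exact (Nat.prime_dvd_prime_iff_eq hp hrp).mp (hp.dvd_of_dvd_pow h1)
    exact hpr ▸ hr
  obtain ⟨K, hK⟩ := hdvd
  have hpq : p - 1 ∣ q - 1 := by
    rw [hq]
    simpa using Nat.sub_dvd_pow_sub_pow p 1 m
  have hqK : q - 1 = 4 * ((p - 1) * K) := by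
    rw [← Nat.mul_div_cancel' hpq, hK]
    ring
  have hnK : n = (p - 1) * K := by omega
  have hqn : q = 4 * n + 1 := by omega
  have hn0 : 0 < n := by omega
  have hcard' : Fintype.card F = 4 * n + 1 := hF.trans hqn
  have hpn : p - 1 ∣ n := ⟨K, hnK⟩
  have hdvd' : 4 ∣ (p ^ m - 1) / (p - 1) := hq ▸ ⟨K, hK⟩
  obtain ⟨g, hg⟩ := IsCyclic.exists_generator (α := Fˣ)
  obtain ⟨ψ, hψ⟩ := exists_isPrimitive_addChar_complex F
  obtain ⟨e, he, he4, hs, hG, hN, hJ⟩ := exists_quartic_periods hcard' hg hp hcard hn0 hpn hψ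
  have hneg : (-1 : F) ∈ fourthPowers F := by
    have h1 : ((p - 1 : ℕ) : F) = -1 := by
      rw [Nat.cast_sub hp.one_lt.le, CharP.cast_eq_zero, Nat.cast_one, zero_sub]
    rw [← h1]
    exact natCast_mem_fourthPowers hcard' hg hpn (by rw [h1]; exact neg_ne_zero.mpr one_ne_zero)
  have hadj := genPaley_four_adj_iff hneg
  have hspec := graphSpectrum_genPaley_four hcard' hg hneg hψ he he4
  have hqZ : (p : ℤ) ^ m = q := by
    rw [hq]
    push_cast
    rfl
  have hper : ∀ k, ∃ j < 4, e k = e j := fun k => by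
    refine ⟨k % 4, Nat.mod_lt _ (by norm_num), ?_⟩
    conv_lhs => rw [← Nat.mod_add_div k 4]
    exact periodic_eq_of_period_four he4 _ _
  refine ⟨fun v w => (hadj v w).trans mem_fourthPowers, ?_, ?_, ?_, ?_⟩
  · refine connected_of_charSum_ne hψ _ _ hadj ?_
    intro a ha hcontra
    obtain ⟨k, _, rfl⟩ := exists_generator_pow_eq hcard' hg ha
    rw [he, card_fourthPowers hcard' hg] at hcontra
    have hen : e k = n := by exact_mod_cast hcontra
    rw [hqZ] at hG hN
    have hq5' : (5 : ℤ) ≤ q := by exact_mod_cast hq5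
    have hq9' : (q : ℤ) ≠ 9 := by exact_mod_cast hq9
    have hqn' : (q : ℤ) = 4 * n + 1 := by exact_mod_cast hqn
    -- Solving the linear relations, `4 e k + 1` is the alternating sum, with sign `(-1)^k`, plus
    -- `±2` times a difference. The four sign patterns follow.
    have hG' : (-(e 0 - e 1 + e 2 - e 3)) ^ 2 = (q : ℤ) := by rw [neg_sq, hG]
    have hu : (e 0 - e 2) ^ 2 ≤ (q : ℤ) := by nlinarith [sq_nonneg (e 1 - e 3)]
    have hv : (e 1 - e 3) ^ 2 ≤ (q : ℤ) := by nlinarith [sq_nonneg (e 0 - e 2)]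
    have hu' : (-(e 0 - e 2)) ^ 2 ≤ (q : ℤ) := by rwa [neg_sq]
    have hv' : (-(e 1 - e 3)) ^ 2 ≤ (q : ℤ) := by rwa [neg_sq]
    have h0 := add_two_mul_ne_of_sq_eq hG hu hq5' hq9'
    have h1 := add_two_mul_ne_of_sq_eq hG' hv hq5' hq9'
    have h2 := add_two_mul_ne_of_sq_eq hG hu' hq5' hq9'
    have h3 := add_two_mul_ne_of_sq_eq hG' hv' hq5' hq9'
    obtain ⟨j, hj, hkj⟩ := hper k
    rw [hkj] at hen
    interval_cases j <;> omega
  · intro x hx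
    rw [hspec] at hx
    simp only [Multiset.mem_add, Multiset.mem_singleton, Multiset.mem_replicate] at hx
    rcases hx with h | (⟨_, h⟩ | ⟨_, h⟩) | (⟨_, h⟩ | ⟨_, h⟩)
    · exact ⟨n, by simpa using h⟩
    all_goals exact ⟨_, h⟩
  · intro hp1
    have hp1' : p % 4 = 1 := hp1
    have hp2 : p ≠ 2 := by omega
    obtain ⟨t, rfl⟩ := four_dvd_of_four_dvd_div hp.two_le hp1' hdvd'
    have ht : t ≠ 0 := by omega
    obtain ⟨c₀, d₀, hpair, hval⟩ :=
      exists_quartic_pair_periods hp hp1' ht hs hG hN (hJ hp1')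
    have huniq : ∀ c d c' d' : ℤ, IsQuarticPair p q c d → IsQuarticPair p q c' d' →
        c' ^ 2 = c ^ 2 ∧ d' ^ 2 = d ^ 2 := by
      intro c d c' d' h h'
      rw [hq, isQuarticPair_iff] at h h'
      exact sq_eq_sq_of_sq_add_four_mul_sq hp hp2 h.1 h'.1 h.2.2 h'.2.2 (by omega)
    have hpair₀ : IsQuarticPair p q c₀ d₀ := by
      rw [hq, isQuarticPair_iff]
      exact hpair
    refine ⟨⟨t, rfl⟩, ⟨c₀, d₀, hpair₀⟩, ?_, ?_⟩
    · intro c d c' d' h h'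
      obtain ⟨h1, h2⟩ := huniq c d c' d' h h'
      have hc : c % 4 = 1 := h.2.1
      have hc' : c' % 4 = 1 := h'.2.1
      refine ⟨?_, sq_eq_sq_iff_eq_or_eq_neg.mp h2⟩
      rcases sq_eq_sq_iff_eq_or_eq_neg.mp h1 with h3 | h3 <;> omega
    · intro c d h
      -- The periods involve only `c₀²` and `d₀²`, so the given pair may replace the one found.
      obtain ⟨hc, hd⟩ := huniq c d c₀ d₀ h hpair₀
      have hp5 : 5 ≤ p := by
        have := hp.two_le
        omega
      have hr5 : 5 ≤ p ^ t := hp5.trans (Nat.le_self_pow ht p)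
      have hqr : (q : ℝ) = ((p : ℝ) ^ t) ^ 4 := by
        rw [hq, ← pow_mul, mul_comm]
        push_cast
        rfl
      have hr5' : (5 : ℝ) ≤ (p : ℝ) ^ t := by exact_mod_cast hr5
      have hquart : (q : ℝ) ^ (1 / 4 : ℝ) = (p : ℝ) ^ t := by
        rw [hqr, ← pow_mul, mul_comm]
        exact rpow_quarter_pow_four_mul (Nat.cast_nonneg p) t
      have hsqrt : √(q : ℝ) = ((p : ℝ) ^ t) ^ 2 := by
        rw [hqr, Real.sqrt_eq_iff_mul_self_eq (by positivity) (by positivity)]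
        ring
      have hcdr : ((p : ℝ) ^ t) ^ 2 = (c : ℝ) ^ 2 + 4 * (d : ℝ) ^ 2 := hsqrt.symm.trans h.1
      rw [hq, isQuarticPair_iff] at h
      rw [hc, hd] at hval
      have hc0 : (c : ℝ) ≠ 0 := by
        have : c % 4 = 1 := h.2.1
        exact_mod_cast (by omega : c ≠ 0)
      have hd0 : (d : ℝ) ≠ 0 := by
        intro h0
        have h0' : d = 0 := by exact_mod_cast h0
        have hpi : Prime (p : ℤ) := Nat.prime_iff_prime_int.mp hp
        have hpc : (p : ℤ) ∣ c ^ 2 := by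
          have h1 := h.1
          rw [h0', zero_pow two_ne_zero, mul_zero, add_zero] at h1
          rw [h1]
          exact dvd_pow_self _ (by omega)
        exact hpi.not_isUnit (h.2.2.symm.isUnit_of_dvd (hpi.dvd_of_dvd_pow hpc))
      have hnr : (n : ℝ) = (((p : ℝ) ^ t) ^ 4 - 1) / 4 := by
        rw [← hqr, hqn]
        push_cast
        ring
      have hcast : ((p ^ t : ℕ) : ℝ) = (p : ℝ) ^ t := by push_cast; rfl
      rw [hsqrt, hquart]
      refine ⟨?_, ?_, ?_⟩
      · simp only [List.map_cons, List.map_nil]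
        rw [hnr]
        exact nodup_quartic_values hcdr hc0 hd0 (by linarith)
      · simp [hn0]
      · rw [hspec]
        simp only [List.map_cons, List.map_nil, List.sum_cons, List.sum_nil, add_zero,
          Multiset.replicate_one]
        congr 1
        have e1 := fun (x y : ℤ) hS hD => replicate_periods_eq (x := x) (y := y)
          (S := ((p : ℝ) ^ t) ^ 2 - 1) (D := 4 * d * (p : ℝ) ^ t) hS hD n
        have e2 := fun (x y : ℤ) hS hD => replicate_periods_eq (x := x) (y := y)
          (S := -((p : ℝ) ^ t) ^ 2 - 1) (D := 2 * c * (p : ℝ) ^ t) hS hD n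
        rw [show ((p : ℝ) ^ t) ^ 2 + 4 * d * (p : ℝ) ^ t - 1
            = ((p : ℝ) ^ t) ^ 2 - 1 + 4 * d * (p : ℝ) ^ t by ring,
          show ((p : ℝ) ^ t) ^ 2 - 4 * d * (p : ℝ) ^ t - 1
            = ((p : ℝ) ^ t) ^ 2 - 1 - 4 * d * (p : ℝ) ^ t by ring,
          show -((p : ℝ) ^ t) ^ 2 + 2 * c * (p : ℝ) ^ t - 1
            = -((p : ℝ) ^ t) ^ 2 - 1 + 2 * c * (p : ℝ) ^ t by ring,
          show -((p : ℝ) ^ t) ^ 2 - 2 * c * (p : ℝ) ^ t - 1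
            = -((p : ℝ) ^ t) ^ 2 - 1 - 2 * c * (p : ℝ) ^ t by ring]
        rcases hval with ⟨h1, h2, h3, h4⟩ | ⟨h1, h2, h3, h4⟩ <;>
          replace h1 := congrArg (Int.cast : ℤ → ℝ) h1 <;>
          replace h2 := congrArg (Int.cast : ℤ → ℝ) h2 <;>
          replace h3 := congrArg (Int.cast : ℤ → ℝ) h3 <;>
          replace h4 := congrArg (Int.cast : ℤ → ℝ) h4 <;>
          push_cast at h1 h2 h3 h4
        · rw [e2 (e 0) (e 2) (by linear_combination h1) (by linear_combination h2),
            e1 (e 1) (e 3) (by linear_combination h3) (by linear_combination h4)]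
          abel
        · rw [e2 (e 1) (e 3) (by linear_combination h1) (by linear_combination h2),
            e1 (e 0) (e 2) (by linear_combination h3) (by linear_combination h4)]
          abel
  · intro hp3
    have hp3' : p % 4 = 3 := hp3
    obtain ⟨s, rfl⟩ := two_dvd_of_four_dvd_div hp.two_le (by omega) hdvd'
    have hPs : (p : ℤ) ^ (2 * s) = ((p : ℤ) ^ s) ^ 2 := by rw [← pow_mul, mul_comm]
    have h0 := eq_zero_or_eq_zero_of_sq_add_sq_eq_pow hp hp3' s _ _ hN
    have hqr : (q : ℝ) = ((p : ℝ) ^ s) ^ 2 := by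
      rw [hq, ← pow_mul, mul_comm]
      push_cast
      rfl
    have hsqrt : √(q : ℝ) = (p : ℝ) ^ s := by
      rw [hqr, Real.sqrt_sq (by positivity)]
    have hnr : (n : ℝ) = ((q : ℝ) - 1) / 4 := by
      rw [hqn]
      push_cast
      ring
    have hq5r : (5 : ℝ) ≤ q := by exact_mod_cast hq5
    have hq9r : (q : ℝ) ≠ 9 := by exact_mod_cast hq9
    have hmod : (p : ℤ) ^ s ≡ (-1) ^ s [ZMOD 4] := by
      refine Int.ModEq.pow s ?_
      rw [Int.ModEq]
      omega
    have hρ : ∀ ρ : ℤ, ρ ^ 2 = ((p : ℤ) ^ s) ^ 2 → ρ % 4 = 1 →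
        _ := fun ρ h1 h2 => semiprimitive_periods hs (hG.trans (hPs.trans h1.symm))
          (hN.trans (hPs.trans h1.symm)) h0 h2
    -- Equality with `n = (ρ² - 1)/4` would force `ρ = 1` or `ρ = -3`, that is `q = 1` or `q = 9`.
    have hne : ∀ ρ : ℝ, ρ ^ 2 = q → (n : ℝ) ≠ (ρ - 1) / 4 ∧ (n : ℝ) ≠ (-3 * ρ - 1) / 4 ∧
        (ρ - 1) / 4 ≠ (-3 * ρ - 1) / 4 := by
      intro ρ h1
      have hρ0 : ρ ≠ 0 := by
        rintro rfl
        linarith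
      rw [hnr, ← h1]
      rw [← h1] at hq5r hq9r
      refine ⟨fun h2 => ?_, fun h2 => ?_, fun h2 => hρ0 (by linarith)⟩
      · have h3 : ρ = 1 := mul_left_cancel₀ hρ0 (by linear_combination 4 * h2)
        rw [h3] at hq5r
        norm_num at hq5r
      · have h3 : ρ = -3 := mul_left_cancel₀ hρ0 (by linear_combination 4 * h2)
        rw [h3] at hq9r
        norm_num at hq9r
    refine ⟨⟨s, rfl⟩, ?_, ?_, ?_⟩
    · intro hm4
      have hs2 : Even s := by
        rw [Nat.even_iff]
        have : (2 * s) % 4 = 0 := hm4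
        omega
      rw [hs2.neg_one_pow] at hmod
      obtain ⟨n1, n2, n3⟩ := hne ((p : ℝ) ^ s) hqr.symm
      rw [hsqrt]
      refine ⟨List.nodup_triple_of_ne n1 n2 n3, by simp [hn0], ?_⟩
      rw [hspec, replicate_semiprimitive_periods n (hρ ((p : ℤ) ^ s) rfl hmod)]
      simp
    · intro hm4
      have hs2 : Odd s := by
        rw [Nat.odd_iff]
        have : (2 * s) % 4 = 2 := hm4
        omega
      rw [hs2.neg_one_pow] at hmod
      -- For odd `s` the root of `q` that is 1 modulo 4 is `-p^s`, which exchanges the roles of the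
      -- two multiplicities.
      obtain ⟨n1, n2, n3⟩ := hne (-(p : ℝ) ^ s) (by rw [neg_sq, hqr])
      have h3 : (-3 * -(p : ℝ) ^ s - 1) / 4 = (3 * (p : ℝ) ^ s - 1) / 4 := by ring
      rw [h3] at n2 n3
      rw [hsqrt]
      refine ⟨List.nodup_triple_of_ne n2 n1 n3.symm, by simp [hn0], ?_⟩
      rw [hspec, replicate_semiprimitive_periods n
        (hρ (-(p : ℤ) ^ s) (neg_sq _) (by rw [Int.ModEq] at hmod; omega))]
      push_cast
      rw [h3]
      simp [add_comm]
    · obtain ⟨ρ, hρ1, hρ2⟩ : ∃ ρ : ℤ, ρ ^ 2 = ((p : ℤ) ^ s) ^ 2 ∧ ρ % 4 = 1 := by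
        rw [Int.ModEq] at hmod
        rcases neg_one_pow_eq_or ℤ s with h | h <;> rw [h] at hmod
        · exact ⟨_, rfl, hmod⟩
        · exact ⟨-(p : ℤ) ^ s, neg_sq _, by omega⟩
      have hper' := hρ ρ hρ1 hρ2
      have hval : ∀ k, 4 * e k + 1 = ρ ∨ 4 * e k + 1 = -3 * ρ := by
        intro k
        obtain ⟨j, hj, hkj⟩ := hper k
        rw [hkj]
        interval_cases j <;> omega
      refine ⟨?_, ?_, ?_⟩
      · intro htop
        have h1 : (genPaley 4 F).Adj 0 g := by
          rw [htop, SimpleGraph.top_adj]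
          exact g.ne_zero.symm
        rw [hadj, sub_zero, ← pow_one (g : F), generator_pow_mem_fourthPowers_iff hcard' hg] at h1
        omega
      · intro hbot
        have h1 : (genPaley 4 F).Adj 0 1 := by
          rw [hadj, sub_zero, ← pow_zero (g : F), generator_pow_mem_fourthPowers_iff hcard' hg]
          exact dvd_zero 4
        rw [hbot] at h1
        exact h1
      -- The constants are the sum and the product of `(ρ - 1)/4` and `(-3ρ - 1)/4`.
      · refine isSRGWith_of_charSum_quadratic hψ _ _ hadj (((-2 * ρ - 2 : ℤ) : ℂ) / 4)
          (((ρ - 1) * (-3 * ρ - 1) : ℤ) / 16) ?_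
        intro a ha
        obtain ⟨k, _, rfl⟩ := exists_generator_pow_eq hcard' hg ha
        rw [he]
        have h1 : (4 * e k + 1 - ρ) * (4 * e k + 1 + 3 * ρ) = 0 := by
          rcases hval k with h | h <;> rw [h] <;> ring
        have h2 := congrArg (Int.cast : ℤ → ℂ) h1
        push_cast at h2 ⊢
        linear_combination h2 / 16
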